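/- Let $k$ be an algebraically closed field and let $X$ be a smooth surface over $k$, that is, a separated scheme of finite type over $k$ that is smooth of relative dimension $2$ (not necessarily irreducible). Let $\mathcal T$ and $\mathcal N$ be coherent sheaves on $X$ such that the support of each is the union of a finite set of closed points and a finite set of irreducible closed curves. Call an irreducible closed subset of $X$ an associated subvariety of a coherent sheaf $\mathcal F$ if it is the closure of an associated point of $\mathcal F$, i.e. of a point $x \in X$ such that the maximal ideal of $\mathcal O_{X,x}$ is an associated prime of the $\mathcal O_{X,x}$-module $\mathcal F_x$ (so embedded components are included). Then the sheaf $\mathcal{T}or_1^X(\mathcal T, \mathcal N)$ is nonzero if and only if some associated subvariety of $\mathcal T$ contains an associated subvariety of $\mathcal N$ or some associated subvariety of $\mathcal N$ contains an associated subvariety of $\mathcal T$. -/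

import Mathlib

open CategoryTheory Limits MonoidalCategory AlgebraicGeometry Opposite

universe u

namespace PresheafOfModules

/-- The free presheaf of modules on a representable presheaf is projective, as maps out of it
are sections. -/
instance projective_free_yoneda {C : Type u} [SmallCategory.{u} C] {R : Cᵒᵖ ⥤ RingCat.{u}}
    (U : C) : Projective ((free R).obj (yoneda.obj U)) where
  factors {E N} f e _ := by
    obtain ⟨y, hy⟩ := surjective_of_epi e (op U) (freeYonedaEquiv f)
    refine ⟨freeYonedaEquiv.symm y, freeYonedaEquiv.injective ?_⟩
    rw [freeYonedaEquiv_comp, Equiv.apply_symm_apply, hy]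

/-- Every presheaf of modules is a quotient of a projective one. -/
instance enoughProjectives {C : Type u} [SmallCategory.{u} C] (R : Cᵒᵖ ⥤ RingCat.{u}) :
    EnoughProjectives (PresheafOfModules.{u} R) where
  presentation M := ⟨{ p := M.freeYonedaCoproduct, f := M.fromFreeYonedaCoproduct }⟩

/-- The sectionwise tensor product of presheaves of modules is biadditive. -/
instance monoidalPreadditive {C : Type u} [SmallCategory.{u} C] (R : Cᵒᵖ ⥤ CommRingCat.{u}) :
    MonoidalPreadditive (PresheafOfModules.{u} (R ⋙ forget₂ CommRingCat RingCat)) where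
  whiskerLeft_zero := by
    intros; ext1 U
    exact MonoidalPreadditive.whiskerLeft_zero (C := ModuleCat (R.obj U))
  zero_whiskerRight := by
    intros; ext1 U
    exact MonoidalPreadditive.zero_whiskerRight (C := ModuleCat (R.obj U))
  whiskerLeft_add := by
    intros; ext1 U
    exact MonoidalPreadditive.whiskerLeft_add (C := ModuleCat (R.obj U)) _ _
  add_whiskerRight := by
    intros; ext1 U
    exact MonoidalPreadditive.add_whiskerRight (C := ModuleCat (R.obj U)) _ _

end PresheafOfModules

namespace AlgebraicGeometry.Scheme.Modules

variable {X : Scheme.{u}}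

/-- `Tor_n` of the presheaves of modules underlying `M` and `N`: the `n`-th left derived functor of
the sectionwise tensor product of presheaves of `𝒪_X`-modules. Evaluation at an open set `U` is
exact, monoidal and preserves projectives, so the sections over `U` are
`Tor_n^{𝒪_X(U)}(M(U), N(U))`. -/
noncomputable def torPresheaf (n : ℕ) (M N : X.Modules) : X.PresheafOfModules :=
  ((Tor (_root_.PresheafOfModules.{u} (X.presheaf ⋙ forget₂ CommRingCat RingCat)) n).obj
    M.val).obj N.val

/-- The sheaf `𝒯or_n^X(M, N)` of `𝒪_X`-modules, i.e. the sheaf associated with the presheaf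
`U ↦ Tor_n^{𝒪_X(U)}(M(U), N(U))`. Sheafification is exact, monoidal and takes projective presheaves
of modules to flat sheaves, so this is the homology of `M ⊗ P` for a flat resolution `P` of `N` by
sheaves of `𝒪_X`-modules. -/
noncomputable def torSheaf (n : ℕ) (M N : X.Modules) : X.Modules :=
  (_root_.PresheafOfModules.sheafification (𝟙 X.ringCatSheaf.obj)).obj (torPresheaf n M N)

/-- Coherent sheaves of modules on a locally noetherian scheme: quasi-coherent and of finite
type. -/
structure IsCoherent (M : X.Modules) : Prop where
  isQuasicoherent : M.IsQuasicoherent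
  isFiniteType : M.IsFiniteType

/-- The stalk `M_x` as a module over the local ring `𝒪_{X,x}`. -/
noncomputable instance stalkModule (M : X.Modules) (x : X) :
    Module (X.presheaf.stalk x) (M.presheaf.stalk x) :=
  _root_.PresheafOfModules.instModuleCarrierStalkCommRingCatCarrierAbPresheafOpensCarrier
    (R := X.presheaf) M.val x

lemma stalk_germ_smul (M : X.Modules) (x : X) (U : X.Opens) (hx : x ∈ U) (r : Γ(X, U))
    (m : M.presheaf.obj (op U)) :
    M.presheaf.germ U x hx (r • m) = X.presheaf.germ U x hx r • M.presheaf.germ U x hx m :=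
  _root_.PresheafOfModules.germ_smul (R := X.presheaf) M.val x U hx r m

/-- The set-theoretic support of a sheaf of modules. -/
def support (M : X.Modules) : Set X :=
  {x | Nontrivial (M.presheaf.stalk x)}

/-- The associated points of a sheaf of modules: the points `x` such that the maximal ideal of
`𝒪_{X,x}` is an associated prime of the stalk at `x`. -/
def associatedPoints (M : X.Modules) : Set X :=
  {x | IsLocalRing.maximalIdeal (X.presheaf.stalk x) ∈
    associatedPrimes (X.presheaf.stalk x) (M.presheaf.stalk x)}

/-- The irreducible subvarieties belonging to `M`, embedded ones included: the closures of the
associated points of `M`. -/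
def associatedSubvarieties (M : X.Modules) : Set (Set X) :=
  {Z | ∃ x ∈ M.associatedPoints, Z = closure {x}}

/-- The support of `M` is the union of finitely many closed points and finitely many irreducible
closed curves. -/
def IsSupportedOnPointsAndCurves (M : X.Modules) : Prop :=
  ∃ (P : Set X) (C : Set (Set X)), P.Finite ∧ (∀ x ∈ P, IsClosed {x}) ∧
    C.Finite ∧ (∀ Z ∈ C, IsClosed Z ∧ IsIrreducible Z ∧ topologicalKrullDim Z = 1) ∧
    M.support = P ∪ ⋃₀ C

end AlgebraicGeometry.Scheme.Modules

/-! The sheaf is nonzero exactly when Tor₁ of the stalks is nonzero at some point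
(`not_isZero_torSheaf_one_iff`). Indeed the presheaf Tor₁ is the kernel of `M ⊗ K ⟶ M ⊗ P` for a
presentation `0 ⟶ K ⟶ P ⟶ N ⟶ 0` with `P` projective; tensor products, kernels and flatness are
compatible with the directed colimits that form stalks, and sheafification preserves stalks. Since X
is locally étale over the affine plane, each local ring R is a noetherian domain with maximal ideal
𝔪 generated by a regular sequence of length at most two. Specialization of points corresponds in a
chart to inclusion of primes, so the rest is algebra over R.

Suppose Tor₁(M, N) ≠ 0. If 𝔪 is associated to M, it contains every associated prime of N. Otherwise
M has a free resolution 0 → K → Rⁿ → M → 0, and Tor₁(M, N) is a submodule of K ⊗ N, a finite power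
of N. An associated prime q of it is associated to N; it contains the annihilator of M, hence a
minimal prime over that annihilator, and this prime is associated to M
(`HasShortRegularSystem.exists_associatedPrimes_le`).

Conversely, at the smaller of the two subvarieties 𝔪 is associated to N, while M is nonzero and
torsion. If M has a resolution as above, Tor₁(M, R/𝔪) embeds in Tor₁(M, N); its vanishing would make
M free. Otherwise 𝔪 is associated to both modules. Tor₁ of their largest submodules of finite length
embeds in Tor₁(M, N), and it is nonzero because the Euler characteristic of Tor vanishes while the
tensor product does not (`IsRegularParameterPair.not_torOneVanishes`). -/

/-! ### Tor₁ of modules, tested by injectivity. -/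

section LocalAlgebra

open TensorProduct IsLocalRing Function

/-- The vanishing of `Tor₁^R(M, N)`, tested on the standard free cover of `N`. -/
def TorOneVanishes (R M N : Type*) [CommRing R] [AddCommGroup M] [Module R M] [AddCommGroup N]
    [Module R N] : Prop :=
  Injective ((LinearMap.ker (Finsupp.linearCombination R (id : N → N))).subtype.lTensor M)

namespace TorOneVanishes

variable {R M N K P : Type*} [CommRing R] [AddCommGroup M] [Module R M] [AddCommGroup N]
  [Module R N] [AddCommGroup K] [Module R K] [AddCommGroup P] [Module R P]

/-- Balancing of Tor₁: it may be computed from a flat cover of either argument. This gives both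
symmetry and independence of the cover. -/
lemma rTensor_injective_iff_lTensor_injective {L Q : Type*} [AddCommGroup L] [Module R L]
    [AddCommGroup Q] [Module R Q] [Module.Flat R P] [Module.Flat R Q]
    {f : K →ₗ[R] P} {g : P →ₗ[R] N} (hf : Injective f) (hfg : Exact f g) (hg : Surjective g)
    {i : L →ₗ[R] Q} {p : Q →ₗ[R] M} (hi : Injective i) (hip : Exact i p) (hp : Surjective p) :
    Injective (f.rTensor M) ↔ Injective (i.lTensor N) :=
  ⟨fun h ↦ lTensor_injective_of_exact_of_exact_of_rTensor_injective hfg hg hip hp h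
      (Module.Flat.lTensor_preserves_injective_linearMap i hi),
    fun h ↦ (LinearMap.lTensor_inj_iff_rTensor_inj _ _).mp
      (lTensor_injective_of_exact_of_exact_of_rTensor_injective hip hp hfg hg
        ((LinearMap.lTensor_inj_iff_rTensor_inj _ _).mp h)
        (Module.Flat.lTensor_preserves_injective_linearMap f hf))⟩

lemma linearCombination_id_surjective :
    Surjective (Finsupp.linearCombination R (id : N → N)) :=
  Finsupp.linearCombination_id_surjective R N

variable (R M N) in
lemma comm : TorOneVanishes R M N ↔ TorOneVanishes R N M := by
  unfold TorOneVanishes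
  rw [LinearMap.lTensor_inj_iff_rTensor_inj]
  exact rTensor_injective_iff_lTensor_injective (Submodule.injective_subtype _)
    (LinearMap.exact_subtype_ker_map _) linearCombination_id_surjective
    (Submodule.injective_subtype _) (LinearMap.exact_subtype_ker_map _)
    linearCombination_id_surjective

lemma iff_of_flat_left [Module.Flat R P] {f : K →ₗ[R] P} {g : P →ₗ[R] M}
    (hf : Injective f) (hfg : Exact f g) (hg : Surjective g) :
    TorOneVanishes R M N ↔ Injective (f.rTensor N) :=
  (rTensor_injective_iff_lTensor_injective hf hfg hg (Submodule.injective_subtype _)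
    (LinearMap.exact_subtype_ker_map _) linearCombination_id_surjective).symm

lemma iff_of_flat_right [Module.Flat R P] {f : K →ₗ[R] P} {g : P →ₗ[R] N}
    (hf : Injective f) (hfg : Exact f g) (hg : Surjective g) :
    TorOneVanishes R M N ↔ Injective (f.lTensor M) := by
  rw [comm, iff_of_flat_left hf hfg hg, LinearMap.lTensor_inj_iff_rTensor_inj]

lemma of_subsingleton [Subsingleton N] : TorOneVanishes R M N :=
  have : Surjective (0 : PUnit →ₗ[R] N) := fun x ↦ ⟨0, Subsingleton.elim _ _⟩
  (iff_of_flat_right (f := (0 : PUnit →ₗ[R] PUnit)) (g := (0 : PUnit →ₗ[R] N))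
    (fun _ _ _ ↦ rfl) (fun x ↦ by simp) this).mpr (fun x y _ ↦ by
      have : Subsingleton (M ⊗[R] PUnit) := inferInstance
      exact Subsingleton.elim _ _)

end TorOneVanishes

/-! ### Local rings with one or two regular parameters. -/

variable {R : Type u} [CommRing R] [IsLocalRing R] [IsNoetherianRing R]

/-- `a` is a regular element generating the maximal ideal. -/
structure IsRegularParameter (a : R) : Prop where
  isSMulRegular : IsSMulRegular R a
  maximalIdeal_eq : maximalIdeal R = Ideal.span {a}

/-- `a, b` is a regular sequence generating the maximal ideal. -/
structure IsRegularParameterPair (a b : R) : Prop where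
  isSMulRegular : IsSMulRegular R a
  dvd_of_dvd_mul : ∀ c, a ∣ b * c → a ∣ c
  maximalIdeal_eq : maximalIdeal R = Ideal.span {a, b}

omit [IsNoetherianRing R] in
lemma IsLocalRing.free_of_maximalIdeal_eq_bot (h : maximalIdeal R = ⊥) {K : Type*} [AddCommGroup K]
    [Module R K] : Module.Free R K := by
  let := (isField_iff_maximalIdeal_eq.mpr h).toField
  infer_instance

/-- By the local criterion it suffices that 𝔪 ⊗ K → K is injective. As 𝔪 = (a), every tensor has the
form a ⊗ v and maps to av, and a is regular on Rⁿ. -/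
lemma IsRegularParameter.free {a : R} (h : IsRegularParameter a) {n : ℕ}
    (K : Submodule R (Fin n → R)) : Module.Free R K := by
  have : Module.FinitePresentation R K := Module.finitePresentation_of_finite R K
  refine Module.free_of_maximalIdeal_rTensor_injective ?_
  have ha : a ∈ maximalIdeal R := by
    rw [h.maximalIdeal_eq]; exact Ideal.mem_span_singleton_self a
  have key (t : maximalIdeal R ⊗[R] K) : ∃ v : K, t = ⟨a, ha⟩ ⊗ₜ v := by
    induction t with
    | zero => exact ⟨0, by simp⟩
    | add s t hs ht =>
      obtain ⟨v, rfl⟩ := hs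
      obtain ⟨w, rfl⟩ := ht
      exact ⟨v + w, by rw [TensorProduct.tmul_add]⟩
    | tmul m v =>
      obtain ⟨c, hc⟩ := Ideal.mem_span_singleton'.mp (h.maximalIdeal_eq.le m.2)
      refine ⟨c • v, ?_⟩
      rw [← TensorProduct.smul_tmul]
      congr 1
      exact Subtype.ext hc.symm
  rw [injective_iff_map_eq_zero]
  intro t ht
  obtain ⟨v, rfl⟩ := key t
  have h1 : a • v = 0 := by
    have := congrArg (TensorProduct.lid R K) ht
    simpa using this
  have h2 : v = 0 := by
    apply Subtype.ext
    funext i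
    exact h.isSMulRegular (by simpa using congrFun (congrArg Subtype.val h1) i)
  rw [h2, TensorProduct.tmul_zero]

/-- The condition `hK` says that Rⁿ/K has no element killed by 𝔪, that is, positive depth; so this
is Auslander–Buchsbaum in dimension two. The local criterion applies again, now with the Koszul
relations between a and b. -/
lemma IsRegularParameterPair.free {a b : R} (h : IsRegularParameterPair a b) {n : ℕ}
    (K : Submodule R (Fin n → R)) (hK : ∀ v, a • v ∈ K → b • v ∈ K → v ∈ K) :
    Module.Free R K := by
  have : Module.FinitePresentation R K := Module.finitePresentation_of_finite R K
  refine Module.free_of_maximalIdeal_rTensor_injective ?_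
  have ha : a ∈ maximalIdeal R := by
    rw [h.maximalIdeal_eq]; exact Ideal.subset_span (by simp)
  have hb : b ∈ maximalIdeal R := by
    rw [h.maximalIdeal_eq]; exact Ideal.subset_span (by simp)
  have key (t : maximalIdeal R ⊗[R] K) :
      ∃ v w : K, t = ⟨a, ha⟩ ⊗ₜ v + ⟨b, hb⟩ ⊗ₜ w := by
    induction t with
    | zero => exact ⟨0, 0, by simp⟩
    | add s t hs ht =>
      obtain ⟨v, w, rfl⟩ := hs
      obtain ⟨v', w', rfl⟩ := ht
      exact ⟨v + v', w + w', by rw [TensorProduct.tmul_add, TensorProduct.tmul_add]; abel⟩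
    | tmul m v =>
      obtain ⟨c, d, hc⟩ := Ideal.mem_span_pair.mp (h.maximalIdeal_eq.le m.2)
      refine ⟨c • v, d • v, ?_⟩
      rw [← TensorProduct.smul_tmul, ← TensorProduct.smul_tmul, ← TensorProduct.add_tmul]
      congr 1
      exact Subtype.ext hc.symm
  rw [injective_iff_map_eq_zero]
  intro t ht
  obtain ⟨v, w, rfl⟩ := key t
  have h1 : a • v + b • w = 0 := by
    have := congrArg (TensorProduct.lid R K) ht
    simpa using this
  have h1' (i) : a * v.1 i + b * w.1 i = 0 := by
    simpa using congrFun (congrArg Subtype.val h1) i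
  -- Exactness of the Koszul complex: av + bw = 0 forces (v, w) = (-bc, ac) with c in Rⁿ. Then `hK`
  -- puts c in K, which makes the tensor vanish already in 𝔪 ⊗ K.
  have h2 (i) : ∃ c, w.1 i = a * c :=
    h.dvd_of_dvd_mul _ ⟨-v.1 i, by linear_combination h1' i⟩
  choose c hc using h2
  have hv : v.1 = - b • c := by
    funext i
    apply h.isSMulRegular
    have := h1' i
    simp only [smul_eq_mul, Pi.smul_apply, neg_mul]
    rw [hc] at this
    linear_combination this
  have hw : w.1 = a • c := by funext i; simp [hc]
  have hcK : c ∈ K := by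
    refine hK c (hw ▸ w.2) ?_
    have := K.neg_mem (hv ▸ v.2)
    simpa using this
  have e1 : v = -b • (⟨c, hcK⟩ : K) := Subtype.ext hv
  have e2 : w = a • (⟨c, hcK⟩ : K) := Subtype.ext hw
  rw [e1, e2, ← TensorProduct.smul_tmul, ← TensorProduct.smul_tmul, ← TensorProduct.add_tmul]
  have : -b • (⟨a, ha⟩ : maximalIdeal R) + a • ⟨b, hb⟩ = 0 := by
    apply Subtype.ext; simp; ring
  rw [this, TensorProduct.zero_tmul]

/-- Krull's intersection theorem writes each nonzero element as aⁿd with a ∤ d. A product of two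
such elements is nonzero because a is regular and (a) is prime. -/
lemma IsLocalRing.isDomain_of_isPrime_span_singleton {a : R} (ha : IsSMulRegular R a)
    (hp : (Ideal.span {a}).IsPrime) : IsDomain R := by
  have hfac (c : R) (hc : c ≠ 0) : ∃ (n : ℕ) (d : R), c = a ^ n * d ∧ ¬ a ∣ d := by
    have hfin : FiniteMultiplicity a c := by
      by_contra hinf
      have h2 := Ideal.iInf_pow_eq_bot_of_isLocalRing _ hp.ne_top
      apply hc
      have : c ∈ (⨅ i : ℕ, Ideal.span {a} ^ i) := by
        rw [Submodule.mem_iInf]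
        intro i
        rw [Ideal.span_singleton_pow, Ideal.mem_span_singleton]
        exact FiniteMultiplicity.not_iff_forall.mp hinf i
      rwa [h2] at this
    exact ⟨_, hfin.exists_eq_pow_mul_and_not_dvd⟩
  have : NoZeroDivisors R := ⟨by
    intro c d hcd
    by_contra! hne
    obtain ⟨n, c', rfl, hc'⟩ := hfac c hne.1
    obtain ⟨m, d', rfl, hd'⟩ := hfac d hne.2
    have h1 : c' * d' = 0 := by
      apply (ha.pow (n + m))
      simp only [smul_eq_mul, mul_zero]
      rw [← hcd]; ring
    have : c' * d' ∈ Ideal.span {a} := h1 ▸ Submodule.zero_mem _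
    rcases hp.mem_or_mem this with h | h
    · exact hc' (Ideal.mem_span_singleton.mp h)
    · exact hd' (Ideal.mem_span_singleton.mp h)⟩
  exact NoZeroDivisors.to_isDomain R

lemma IsRegularParameter.isDomain {a : R} (h : IsRegularParameter a) : IsDomain R :=
  isDomain_of_isPrime_span_singleton h.isSMulRegular (h.maximalIdeal_eq ▸ inferInstance)

/-- In R/(a) the image of b is regular and generates the maximal ideal, so the previous criterion
for domains applies to R/(a). -/
lemma IsRegularParameterPair.isPrime {a b : R} (h : IsRegularParameterPair a b) :
    (Ideal.span {a}).IsPrime := by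
  rw [← Ideal.Quotient.isDomain_iff_prime]
  have hle : Ideal.span {a} ≤ maximalIdeal R := by
    rw [h.maximalIdeal_eq]; exact Ideal.span_mono (by simp)
  have : Nontrivial (R ⧸ Ideal.span {a}) := Ideal.Quotient.nontrivial_iff.mpr
    (ne_top_of_le_ne_top (maximalIdeal.isMaximal R).ne_top hle)
  have : IsLocalRing (R ⧸ Ideal.span {a}) :=
    IsLocalRing.of_surjective' (Ideal.Quotient.mk _) Ideal.Quotient.mk_surjective
  refine isDomain_of_isPrime_span_singleton (a := Ideal.Quotient.mk _ b) ?_ ?_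
  · rw [isSMulRegular_iff_right_eq_zero_of_smul]
    intro c hc
    obtain ⟨c, rfl⟩ := Ideal.Quotient.mk_surjective c
    rw [smul_eq_mul, ← map_mul, Ideal.Quotient.eq_zero_iff_mem, Ideal.mem_span_singleton] at hc
    rw [Ideal.Quotient.eq_zero_iff_mem, Ideal.mem_span_singleton]
    exact h.dvd_of_dvd_mul c hc
  · have h1 : Ideal.span {Ideal.Quotient.mk (Ideal.span {a}) b} =
        (maximalIdeal R).map (Ideal.Quotient.mk (Ideal.span {a})) := by
      rw [h.maximalIdeal_eq, Ideal.map_span, Set.image_pair,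
        Ideal.Quotient.eq_zero_iff_mem.mpr (Ideal.mem_span_singleton_self a),
        Ideal.span_insert_zero]
    rw [h1]
    refine Ideal.map_isPrime_of_surjective Ideal.Quotient.mk_surjective ?_
    rwa [Ideal.mk_ker]

lemma IsRegularParameterPair.isDomain {a b : R} (h : IsRegularParameterPair a b) : IsDomain R :=
  isDomain_of_isPrime_span_singleton h.isSMulRegular h.isPrime

end LocalAlgebra

/-! ### Nonvanishing of Tor₁ and associated primes. -/

section LocalAlgebra

open TensorProduct IsLocalRing Function

variable {R : Type u} [CommRing R] [IsLocalRing R] [IsNoetherianRing R]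

/-- `M` has a resolution of length one by finite free modules. -/
def HasShortFreeResolution (R M : Type*) [CommRing R] [AddCommGroup M] [Module R M] : Prop :=
  ∃ (n : ℕ) (g : (Fin n → R) →ₗ[R] M), Surjective g ∧ Module.Free R (LinearMap.ker g)

variable {M N : Type*} [AddCommGroup M] [Module R M] [AddCommGroup N] [Module R N]

omit [IsNoetherianRing R] in
lemma hasShortFreeResolution_of_maximalIdeal_eq_bot (h : maximalIdeal R = ⊥) [Module.Finite R M] :
    HasShortFreeResolution R M :=
  have ⟨n, g, hg⟩ := Module.Finite.exists_fin' R M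
  ⟨n, g, hg, free_of_maximalIdeal_eq_bot h⟩

lemma IsRegularParameter.hasShortFreeResolution {a : R} (h : IsRegularParameter a)
    [Module.Finite R M] : HasShortFreeResolution R M :=
  have ⟨n, g, hg⟩ := Module.Finite.exists_fin' R M
  ⟨n, g, hg, h.free _⟩

lemma IsRegularParameterPair.free_ker {a b : R} (h : IsRegularParameterPair a b)
    (hM : ∀ v : M, (∀ c ∈ maximalIdeal R, c • v = 0) → v = 0) {n : ℕ} (g : (Fin n → R) →ₗ[R] M) :
    Module.Free R (LinearMap.ker g) := by
  refine h.free _ fun v hv hw ↦ hM _ fun c hc ↦ ?_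
  rw [LinearMap.mem_ker, map_smul] at hv hw
  obtain ⟨d, e, rfl⟩ := Ideal.mem_span_pair.mp (h.maximalIdeal_eq.le hc)
  rw [add_smul, mul_smul, mul_smul, hv, hw, smul_zero, smul_zero, add_zero]

lemma IsRegularParameterPair.hasShortFreeResolution {a b : R} (h : IsRegularParameterPair a b)
    [Module.Finite R M] (hM : ∀ v : M, (∀ c ∈ maximalIdeal R, c • v = 0) → v = 0) :
    HasShortFreeResolution R M :=
  have ⟨n, g, hg⟩ := Module.Finite.exists_fin' R M
  ⟨n, g, hg, h.free_ker hM g⟩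

lemma exists_socle_of_mem_associatedPrimes (hN : maximalIdeal R ∈ associatedPrimes R N) :
    ∃ v : N, v ≠ 0 ∧ ∀ c, c ∈ maximalIdeal R ↔ c • v = 0 := by
  obtain ⟨hp, v, hv⟩ := isAssociatedPrime_iff.mp hN
  have h (c) : c ∈ maximalIdeal R ↔ c • v = 0 := by
    rw [hv, Submodule.mem_colon_singleton, Submodule.mem_bot]
  refine ⟨v, fun h0 ↦ hp.ne_top ?_, h⟩
  rw [Ideal.eq_top_iff_one, h, h0, smul_zero]

omit [IsNoetherianRing R] in
lemma mem_associatedPrimes_of_socle {v : N} (hv : v ≠ 0)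
    (h : ∀ c ∈ maximalIdeal R, c • v = 0) : maximalIdeal R ∈ associatedPrimes R N := by
  refine ⟨inferInstance, v, le_antisymm (fun c hc ↦ Ideal.le_radical ?_) ?_⟩
  · rw [Submodule.mem_colon_singleton, Submodule.mem_bot, h c hc]
  · refine le_maximalIdeal fun htop ↦ hv ?_
    rw [Ideal.radical_eq_top, Ideal.eq_top_iff_one, Submodule.mem_colon_singleton,
      Submodule.mem_bot, one_smul] at htop
    exact htop

/-- A socle element embeds the residue field in N. Tensoring with the free syzygy K keeps this
injective, so Tor₁(M, R/𝔪) lies in Tor₁(M, N). Were it zero, M would be free, against `hsM`. -/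
lemma HasShortFreeResolution.not_torOneVanishes [IsDomain R] (hM : HasShortFreeResolution R M)
    [Module.Finite R M] [Nontrivial M] {s : R} (hs : s ≠ 0) (hsM : ∀ v : M, s • v = 0)
    (hN : maximalIdeal R ∈ associatedPrimes R N) : ¬ TorOneVanishes R M N := by
  intro htor
  obtain ⟨n, g, hg, hfree⟩ := hM
  obtain ⟨v, hv, hvm⟩ := exists_socle_of_mem_associatedPrimes hN
  let j : (R ⧸ maximalIdeal R) →ₗ[R] N :=
    (maximalIdeal R).liftQ (LinearMap.toSpanSingleton R N v) fun c hc ↦ (hvm c).mp hc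
  have hj : Injective j := by
    rw [← LinearMap.ker_eq_bot]
    exact Submodule.ker_liftQ_eq_bot _ _ _ fun c hc ↦ (hvm c).mpr hc
  rw [TorOneVanishes.iff_of_flat_left (Submodule.injective_subtype (LinearMap.ker g))
    (LinearMap.exact_subtype_ker_map _) hg] at htor
  have h1 : TorOneVanishes R M (R ⧸ maximalIdeal R) := by
    rw [TorOneVanishes.iff_of_flat_left (Submodule.injective_subtype (LinearMap.ker g))
      (LinearMap.exact_subtype_ker_map _) hg]
    have h2 : Injective (j.lTensor (LinearMap.ker g)) :=
      Module.Flat.lTensor_preserves_injective_linearMap j hj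
    have h3 := htor.comp h2
    rw [← LinearMap.coe_comp, LinearMap.rTensor_comp_lTensor, ← LinearMap.lTensor_comp_rTensor,
      LinearMap.coe_comp] at h3
    exact h3.of_comp
  rw [TorOneVanishes.iff_of_flat_right (Submodule.injective_subtype (maximalIdeal R))
    (LinearMap.exact_subtype_mkQ _) (Submodule.mkQ_surjective _),
    LinearMap.lTensor_inj_iff_rTensor_inj] at h1
  have : Module.FinitePresentation R M := Module.finitePresentation_of_finite R M
  have hfree := Module.free_of_maximalIdeal_rTensor_injective h1
  obtain ⟨w, hw⟩ := exists_ne (0 : M)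
  exact (smul_eq_zero.mp (hsM w)).elim hs hw

-- The submodule is maximal among the Artinian ones: adjoining v with 𝔪v ⊆ N₀ only adds a quotient
-- of the residue field. It leaves a quotient N/N₀ without socle.
variable (R N) in
lemma exists_isFiniteLength_submodule [Module.Finite R N] : ∃ N₀ : Submodule R N,
    IsFiniteLength R N₀ ∧ ∀ v, (∀ c ∈ maximalIdeal R, c • v ∈ N₀) → v ∈ N₀ := by
  obtain ⟨N₀, hN₀, hmax⟩ := set_has_maximal_iff_noetherian.mpr
    (inferInstanceAs (IsNoetherian R N)) {N' : Submodule R N | IsArtinian R N'}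
    ⟨⊥, inferInstanceAs (IsArtinian R (⊥ : Submodule R N))⟩
  refine ⟨N₀, isFiniteLength_iff_isNoetherian_isArtinian.mpr ⟨inferInstance, hN₀⟩,
    fun v hv ↦ ?_⟩
  by_contra hvN
  let P := N₀ ⊔ Submodule.span R {v}
  have hvP : v ∈ P := Submodule.mem_sup_right (Submodule.mem_span_singleton_self v)
  refine hmax P ?_ (lt_of_le_of_ne le_sup_left fun h ↦ hvN (h ▸ hvP))
  change IsArtinian R P
  let S := N₀.submoduleOf P
  have hS : IsArtinian R S :=
    (Submodule.submoduleOfEquivOfLe (le_sup_left : N₀ ≤ P)).symm.isArtinian_iff.mp hN₀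
  let φ : (R ⧸ maximalIdeal R) →ₗ[R] P ⧸ S :=
    (maximalIdeal R).liftQ (S.mkQ ∘ₗ LinearMap.toSpanSingleton R P ⟨v, hvP⟩) fun c hc ↦ by
      rw [LinearMap.mem_ker, LinearMap.comp_apply, Submodule.mkQ_apply,
        Submodule.Quotient.mk_eq_zero]
      exact hv c hc
  have hφ : Surjective φ := by
    intro w
    obtain ⟨⟨w, hw⟩, rfl⟩ := S.mkQ_surjective w
    obtain ⟨y, hy, z, hz, rfl⟩ := Submodule.mem_sup.mp hw
    obtain ⟨c, rfl⟩ := Submodule.mem_span_singleton.mp hz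
    refine ⟨Submodule.Quotient.mk c, ?_⟩
    simp only [φ, Submodule.liftQ_apply, LinearMap.comp_apply, Submodule.mkQ_apply]
    rw [Submodule.Quotient.eq]
    change c • v - (y + c • v) ∈ N₀
    simpa using hy
  have : IsSimpleModule R (R ⧸ maximalIdeal R) :=
    isSimpleModule_iff_isCoatom.mpr (maximalIdeal.isMaximal R).out
  have hQ : IsArtinian R (P ⧸ S) := isArtinian_of_surjective _ φ hφ
  exact (isArtinian_iff_submodule_quotient S).mpr ⟨hS, hQ⟩

omit [IsNoetherianRing R] in
lemma nontrivial_tensorProduct_of_finite [Module.Finite R M] [Module.Finite R N] [Nontrivial M]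
    [Nontrivial N] : Nontrivial (M ⊗[R] N) := by
  by_contra h
  rw [not_nontrivial_iff_subsingleton] at h
  have h1 : Nontrivial (ResidueField R ⊗[R] M) := by
    rw [← not_subsingleton_iff_nontrivial, IsLocalRing.subsingleton_tensorProduct]
    exact not_subsingleton M
  have h2 : Nontrivial (ResidueField R ⊗[R] N) := by
    rw [← not_subsingleton_iff_nontrivial, IsLocalRing.subsingleton_tensorProduct]
    exact not_subsingleton N
  have h3 : Nontrivial ((ResidueField R ⊗[R] M) ⊗[ResidueField R] (ResidueField R ⊗[R] N)) :=
    inferInstance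
  have e := AlgebraTensorModule.distribBaseChange R (ResidueField R) M N
  have : Subsingleton (ResidueField R ⊗[R] (M ⊗[R] N)) :=
    (IsLocalRing.subsingleton_tensorProduct).mpr h
  exact not_subsingleton _ (e.symm.injective.subsingleton)

omit [IsLocalRing R] [IsNoetherianRing R] in
lemma length_tensorProduct_fin (n : ℕ) :
    Module.length R (M ⊗[R] (Fin n → R)) = n * Module.length R M := by
  rw [(TensorProduct.piScalarRight R R M (Fin n)).length_eq, Module.length_pi]
  simp

/-- Euler characteristic argument: N is torsion, so in a free resolution 0 → Rʳ → Rᵗ → Rⁿ → N → 0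
the ranks satisfy t = n + r. Comparing lengths after tensoring with M, vanishing of Tor₁ would force
M ⊗ N to have length zero. -/
lemma IsRegularParameterPair.not_torOneVanishes_of_isFiniteLength {a b : R}
    (h : IsRegularParameterPair a b) [Nontrivial M] [Nontrivial N]
    (hM : IsFiniteLength R M) (hN : IsFiniteLength R N)
    {s : R} (hs : s ≠ 0) (hsN : ∀ v : N, s • v = 0) : ¬ TorOneVanishes R M N := by
  intro htor
  have := h.isDomain
  have := (isFiniteLength_iff_isNoetherian_isArtinian.mp hM).1
  have := (isFiniteLength_iff_isNoetherian_isArtinian.mp hN).1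
  obtain ⟨n, g, hg⟩ := Module.Finite.exists_fin' R N
  obtain ⟨t, g', hg'⟩ := Module.Finite.exists_fin' R (LinearMap.ker g)
  have ha0 : a ≠ 0 := by
    rintro rfl
    exact one_ne_zero (h.isSMulRegular (a₁ := (1 : R)) (a₂ := 0) (by simp))
  -- The first syzygy lies in a free module over a domain, so it has no socle and the second syzygy
  -- is free.
  have hfree : Module.Free R (LinearMap.ker g') := by
    refine h.free_ker (fun v hv ↦ ?_) g'
    have : a ∈ maximalIdeal R := by
      rw [h.maximalIdeal_eq]; exact Ideal.subset_span (by simp)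
    exact (smul_eq_zero.mp (hv a this)).resolve_left ha0
  rw [TorOneVanishes.iff_of_flat_right (Submodule.injective_subtype (LinearMap.ker g))
    (LinearMap.exact_subtype_ker_map _) hg] at htor
  have hrank1 : Module.finrank R (LinearMap.ker g) = n := by
    have h1 := Submodule.finrank_quotient_add_finrank (LinearMap.ker g)
    rw [(g.quotKerEquivOfSurjective hg).finrank_eq, Module.finrank_fin_fun,
      Module.finrank_eq_zero_iff_isTorsion.mpr, zero_add] at h1
    · exact h1
    · exact fun v ↦ ⟨⟨s, mem_nonZeroDivisors_of_ne_zero hs⟩, hsN v⟩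
  have hrank2 : n + Module.finrank R (LinearMap.ker g') = t := by
    have h1 := Submodule.finrank_quotient_add_finrank (LinearMap.ker g')
    rwa [(g'.quotKerEquivOfSurjective hg').finrank_eq, Module.finrank_fin_fun, hrank1] at h1
  set r := Module.finrank R (LinearMap.ker g')
  have hlen0 : Module.length R (M ⊗[R] LinearMap.ker g') = r * Module.length R M := by
    rw [(TensorProduct.congr (LinearEquiv.refl R M)
      (Module.finBasis R (LinearMap.ker g')).equivFun).length_eq, length_tensorProduct_fin]
  have hlen1 : t * Module.length R M ≤
      r * Module.length R M + Module.length R (M ⊗[R] LinearMap.ker g) := by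
    have hex := lTensor_exact M (LinearMap.exact_subtype_ker_map g') hg'
    have h1 := Module.length_eq_add_of_exact
      (LinearMap.range ((LinearMap.ker g').subtype.lTensor M)).subtype
      (g'.lTensor M) (Submodule.injective_subtype _) (LinearMap.lTensor_surjective _ hg')
      (fun x ↦ by rw [hex x]; simp)
    rw [length_tensorProduct_fin] at h1
    rw [h1, ← hlen0]
    gcongr
    exact Module.length_le_of_surjective _ (LinearMap.surjective_rangeRestrict _)
  have hlen2 := Module.length_eq_add_of_exact _ _ htor (LinearMap.lTensor_surjective M hg)
    (lTensor_exact M (LinearMap.exact_subtype_ker_map g) hg)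
  rw [length_tensorProduct_fin] at hlen2
  have hMtop := Module.length_ne_top_iff.mpr hM
  have hpos : 0 < Module.length R (M ⊗[R] N) :=
    Module.length_pos_iff.mpr nontrivial_tensorProduct_of_finite
  have htop : (n : ℕ∞) * Module.length R M ≠ ⊤ := WithTop.mul_ne_top (ENat.natCast_ne_top n) hMtop
  obtain ⟨lM, hlM⟩ := ENat.ne_top_iff_exists.mp hMtop
  have hA : Module.length R (M ⊗[R] LinearMap.ker g) ≠ ⊤ := fun h ↦ htop (by rw [hlen2, h]; simp)
  have hB : Module.length R (M ⊗[R] N) ≠ ⊤ := fun h ↦ htop (by rw [hlen2, h]; simp)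
  obtain ⟨lA, hlA⟩ := ENat.ne_top_iff_exists.mp hA
  obtain ⟨lB, hlB⟩ := ENat.ne_top_iff_exists.mp hB
  rw [← hlM, ← hlA] at hlen1
  rw [← hlM, ← hlA, ← hlB] at hlen2
  rw [← hlB] at hpos
  norm_cast at hlen1 hlen2 hpos
  rw [← hrank2] at hlen1
  -- With ℓ the length of M, ℓ_A that of M ⊗ ker g and ℓ_B > 0 that of M ⊗ N: (n + r)ℓ ≤ rℓ + ℓ_A
  -- and nℓ = ℓ_A + ℓ_B contradict each other.
  nlinarith

-- The hypothesis `hflat` bounds the flat dimension of N/N₀ by one, so Tor₂(M, N/N₀) = 0 and Tor₁(M,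
-- N₀) embeds in Tor₁(M, N). Concretely, the kernel of Rⁿ → N/N₀ is a flat cover of N₀ with the same
-- syzygy `ker g`, through which the inclusion of `ker g` in Rⁿ factors.
omit [IsLocalRing R] [IsNoetherianRing R] in
lemma TorOneVanishes.of_submodule (h : TorOneVanishes R M N) (N₀ : Submodule R N)
    [Module.Finite R N]
    (hflat : ∀ (n : ℕ) (g : (Fin n → R) →ₗ[R] N ⧸ N₀), Module.Flat R (LinearMap.ker g)) :
    TorOneVanishes R M N₀ := by
  obtain ⟨n, g, hg⟩ := Module.Finite.exists_fin' R N
  have := hflat n (N₀.mkQ ∘ₗ g)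
  rw [iff_of_flat_right (Submodule.injective_subtype (LinearMap.ker g))
    (LinearMap.exact_subtype_ker_map _) hg] at h
  have hle : LinearMap.ker g ≤ LinearMap.ker (N₀.mkQ ∘ₗ g) := LinearMap.ker_le_ker_comp _ _
  let p : LinearMap.ker (N₀.mkQ ∘ₗ g) →ₗ[R] N₀ :=
    (g ∘ₗ Submodule.subtype _).codRestrict N₀ fun v ↦ by
      have hv := v.2
      rwa [LinearMap.mem_ker, LinearMap.comp_apply, Submodule.mkQ_apply,
        Submodule.Quotient.mk_eq_zero] at hv
  rw [iff_of_flat_right (f := Submodule.inclusion hle) (g := p)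
    (Submodule.inclusion_injective hle)]
  · have : (LinearMap.ker g).subtype =
        (LinearMap.ker (N₀.mkQ ∘ₗ g)).subtype ∘ₗ Submodule.inclusion hle := rfl
    rw [this, LinearMap.lTensor_comp, LinearMap.coe_comp] at h
    exact h.of_comp
  · intro v
    constructor
    · intro hv
      exact ⟨⟨v.1, congrArg Subtype.val hv⟩, rfl⟩
    · rintro ⟨w, rfl⟩
      exact Subtype.ext w.2
  · intro w
    obtain ⟨v, hv⟩ := hg w.1
    refine ⟨⟨v, ?_⟩, Subtype.ext hv⟩
    rw [LinearMap.mem_ker, LinearMap.comp_apply, hv, Submodule.mkQ_apply,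
      Submodule.Quotient.mk_eq_zero]
    exact w.2

lemma IsRegularParameter.not_torOneVanishes {a : R} (h : IsRegularParameter a)
    [Module.Finite R M] [Nontrivial M] {s : R} (hs : s ≠ 0) (hsM : ∀ v : M, s • v = 0)
    (hN : maximalIdeal R ∈ associatedPrimes R N) : ¬ TorOneVanishes R M N :=
  have := h.isDomain
  h.hasShortFreeResolution.not_torOneVanishes hs hsM hN

lemma IsRegularParameterPair.exists_submodule {a b : R} (h : IsRegularParameterPair a b)
    [Module.Finite R M] (hM : maximalIdeal R ∈ associatedPrimes R M) : ∃ M₀ : Submodule R M,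
      IsFiniteLength R M₀ ∧ Nontrivial M₀ ∧
      ∀ (n : ℕ) (g : (Fin n → R) →ₗ[R] M ⧸ M₀), Module.Flat R (LinearMap.ker g) := by
  obtain ⟨M₀, hfin, hsoc⟩ := exists_isFiniteLength_submodule R M
  refine ⟨M₀, hfin, ?_, fun n g ↦ ?_⟩
  · obtain ⟨v, hv, hvm⟩ := exists_socle_of_mem_associatedPrimes hM
    have : v ∈ M₀ := hsoc v fun c hc ↦ by rw [(hvm c).mp hc]; exact M₀.zero_mem
    exact ⟨⟨v, this⟩, 0, fun h ↦ hv (congrArg Subtype.val h)⟩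
  · have := h.free_ker (M := M ⧸ M₀) (fun v hv ↦ ?_) g
    · infer_instance
    · obtain ⟨v, rfl⟩ := M₀.mkQ_surjective v
      rw [Submodule.mkQ_apply, Submodule.Quotient.mk_eq_zero]
      refine hsoc v fun c hc ↦ ?_
      rw [← Submodule.Quotient.mk_eq_zero]
      exact hv c hc

/-- If 𝔪 is not associated to M, then M has a short free resolution. If it is, both arguments are
replaced in turn by their largest submodules of finite length. -/
lemma IsRegularParameterPair.not_torOneVanishes {a b : R} (h : IsRegularParameterPair a b)
    [Module.Finite R M] [Nontrivial M] {s : R} (hs : s ≠ 0) (hsM : ∀ v : M, s • v = 0)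
    [Module.Finite R N] (hN : maximalIdeal R ∈ associatedPrimes R N) : ¬ TorOneVanishes R M N := by
  have := h.isDomain
  intro htor
  by_cases hM : maximalIdeal R ∈ associatedPrimes R M
  · obtain ⟨N₀, hfinN, hnN, hflatN⟩ := h.exists_submodule hN
    obtain ⟨M₀, hfinM, hnM, hflatM⟩ := h.exists_submodule hM
    have h1 := htor.of_submodule N₀ hflatN
    rw [TorOneVanishes.comm] at h1
    have h2 := h1.of_submodule M₀ hflatM
    exact h.not_torOneVanishes_of_isFiniteLength hfinN hfinM hs
      (fun v ↦ Subtype.ext (hsM v)) h2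
  · exact (h.hasShortFreeResolution fun v hv ↦ by_contra fun hv0 ↦
      hM (mem_associatedPrimes_of_socle hv0 hv)).not_torOneVanishes hs hsM hN htor

lemma HasShortFreeResolution.exists_associatedPrimes_le (hM : HasShortFreeResolution R M)
    [Module.Finite R M] (h : ¬ TorOneVanishes R M N) :
    ∃ p ∈ associatedPrimes R M, ∃ q ∈ associatedPrimes R N, p ≤ q := by
  obtain ⟨n, g, hg, hfree⟩ := hM
  rw [TorOneVanishes.iff_of_flat_left (Submodule.injective_subtype (LinearMap.ker g))
    (LinearMap.exact_subtype_ker_map _) hg] at h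
  set f := (LinearMap.ker g).subtype
  have : Nontrivial (LinearMap.ker (f.rTensor N)) := by
    rw [injective_iff_map_eq_zero] at h
    push Not at h
    obtain ⟨x, hx, hx0⟩ := h
    exact ⟨⟨x, hx⟩, 0, fun h' ↦ hx0 (congrArg Subtype.val h')⟩
  obtain ⟨q, hq⟩ := associatedPrimes.nonempty R (LinearMap.ker (f.rTensor N))
  obtain ⟨hqp, ⟨l, hl⟩, hql⟩ := isAssociatedPrime_iff.mp hq
  have hql' (c : R) : c ∈ q ↔ c • l = 0 := by
    rw [hql, Submodule.mem_colon_singleton, Submodule.mem_bot, ← Subtype.coe_inj]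
    rfl
  have hqN : q ∈ associatedPrimes R N := by
    let e := TensorProduct.congr (Module.finBasis R (LinearMap.ker g)).equivFun
      (LinearEquiv.refl R N) ≪≫ₗ TensorProduct.comm R _ _ ≪≫ₗ TensorProduct.piScalarRight R R N _
    -- Inside a finite power of N, the annihilator of l is the intersection of those of its
    -- coordinates; being prime, it equals one of them.
    have h1 : q = ⨅ i ∈ Finset.univ, Submodule.colon (⊥ : Submodule R N) {e l i} := by
      ext c
      rw [hql', ← e.map_eq_zero_iff, map_smul]
      simp [funext_iff, Submodule.mem_colon_singleton]
    obtain ⟨i, -, hi⟩ := (hqp.inf_le' (s := Finset.univ)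
      (f := fun i ↦ Submodule.colon (⊥ : Submodule R N) {e l i})).mp
        (by rw [Finset.inf_eq_iInf]; exact h1.ge)
    refine isAssociatedPrime_iff.mpr ⟨hqp, e l i, le_antisymm ?_ hi⟩
    conv_lhs => rw [h1]
    exact iInf₂_le i (Finset.mem_univ i)
  have hann : Module.annihilator R M ≤ q := by
    intro s hs
    rw [Module.mem_annihilator] at hs
    rw [hql']
    -- Since s kills M, multiplication by s maps Rⁿ into the syzygy. Hence s on the syzygy factors
    -- through f, and f ⊗ N kills l.
    let k : (Fin n → R) →ₗ[R] LinearMap.ker g :=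
      (s • LinearMap.id).codRestrict _ fun v ↦ by
        rw [LinearMap.mem_ker, LinearMap.smul_apply, map_smul, hs]
    have h1 : k ∘ₗ f = s • LinearMap.id := rfl
    have h2 := congrArg (fun φ ↦ φ.rTensor N l) h1
    simp only [LinearMap.rTensor_comp, LinearMap.comp_apply] at h2
    rw [LinearMap.mem_ker.mp hl, map_zero, LinearMap.rTensor_smul] at h2
    simpa using h2.symm
  obtain ⟨p, hp, hpq⟩ := Ideal.exists_minimalPrimes_le hann
  exact ⟨p, Module.associatedPrimes.minimalPrimes_annihilator_subset_associatedPrimes R M hp, q,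
    hqN, hpq⟩

/-- The maximal ideal is generated by a regular sequence of length at most two. -/
def HasShortRegularSystem (R : Type*) [CommRing R] [IsLocalRing R] : Prop :=
  maximalIdeal R = ⊥ ∨ (∃ a : R, IsRegularParameter a) ∨ ∃ a b : R, IsRegularParameterPair a b

lemma HasShortRegularSystem.exists_associatedPrimes_le (hR : HasShortRegularSystem R)
    [Module.Finite R M] [Module.Finite R N] (h : ¬ TorOneVanishes R M N) :
    ∃ p ∈ associatedPrimes R M, ∃ q ∈ associatedPrimes R N, p ≤ q ∨ q ≤ p := by
  by_cases hM : maximalIdeal R ∈ associatedPrimes R M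
  · have : Nontrivial N := by
      by_contra hN
      rw [not_nontrivial_iff_subsingleton] at hN
      exact h .of_subsingleton
    obtain ⟨q, hq⟩ := associatedPrimes.nonempty R N
    exact ⟨_, hM, q, hq, Or.inr (le_maximalIdeal hq.1.ne_top)⟩
  · have hres : HasShortFreeResolution R M := by
      rcases hR with hR | ⟨a, hR⟩ | ⟨a, b, hR⟩
      · exact hasShortFreeResolution_of_maximalIdeal_eq_bot hR
      · exact hR.hasShortFreeResolution
      · exact hR.hasShortFreeResolution fun v hv ↦ by_contra fun hv0 ↦
          hM (mem_associatedPrimes_of_socle hv0 hv)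
    obtain ⟨p, hp, q, hq, hpq⟩ := hres.exists_associatedPrimes_le h
    exact ⟨p, hp, q, hq, Or.inl hpq⟩

lemma HasShortRegularSystem.isDomain (hR : HasShortRegularSystem R) : IsDomain R := by
  rcases hR with hR | ⟨a, hR⟩ | ⟨a, b, hR⟩
  · let := (isField_iff_maximalIdeal_eq.mpr hR).toField
    infer_instance
  · exact hR.isDomain
  · exact hR.isDomain

lemma HasShortRegularSystem.not_torOneVanishes (hR : HasShortRegularSystem R)
    (hm : maximalIdeal R ≠ ⊥) [Module.Finite R M] [Nontrivial M] {s : R} (hs : s ≠ 0)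
    (hsM : ∀ v : M, s • v = 0) [Module.Finite R N]
    (hN : maximalIdeal R ∈ associatedPrimes R N) : ¬ TorOneVanishes R M N := by
  rcases hR with hR | ⟨a, hR⟩ | ⟨a, b, hR⟩
  · exact (hm hR).elim
  · exact hR.not_torOneVanishes hs hsM hN
  · exact hR.not_torOneVanishes hs hsM hN

end LocalAlgebra

/-! ### Local rings of étale algebras over the affine plane. -/

section LocalAlgebra

open IsLocalRing Function

section Plane

variable {k : Type*} [Field k]

open MvPolynomial

lemma MvPolynomial.X_sub_C_dvd_iff (a : k) (g : MvPolynomial (Fin 2) k) :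
    X 0 - C a ∣ g ↔ aeval ![C a, X 1] g = (0 : MvPolynomial (Fin 2) k) := by
  constructor
  · rintro ⟨c, rfl⟩
    simp
  · intro h
    rw [← Ideal.mem_span_singleton, ← Ideal.Quotient.eq_zero_iff_mem]
    have key : (Ideal.Quotient.mkₐ k (Ideal.span {X 0 - C a})).comp (aeval ![C a, X 1]) =
        Ideal.Quotient.mkₐ k (Ideal.span {(X 0 - C a : MvPolynomial (Fin 2) k)}) := by
      refine algHom_ext fun i ↦ ?_
      fin_cases i
      · simp only [Fin.zero_eta, AlgHom.comp_apply, aeval_X, Matrix.cons_val_zero]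
        rw [Ideal.Quotient.mkₐ_eq_mk, eq_comm, Ideal.Quotient.eq]
        exact Ideal.mem_span_singleton_self _
      · simp
    have := DFunLike.congr_fun key g
    rw [AlgHom.comp_apply, h, map_zero] at this
    exact this.symm

lemma MvPolynomial.X_sub_C_dvd_of_dvd_mul (a b : k) (g : MvPolynomial (Fin 2) k)
    (h : X 0 - C a ∣ (X 1 - C b) * g) : X 0 - C a ∣ g := by
  rw [X_sub_C_dvd_iff] at h ⊢
  have h1 : (X 1 - C b : MvPolynomial (Fin 2) k) ≠ 0 := fun h0 ↦ by
    have := congrArg (coeff (Finsupp.single 1 1)) h0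
    simp [coeff_C, Finsupp.single_eq_zero, eq_comm] at this
  rw [map_mul] at h
  refine (mul_eq_zero.mp h).resolve_left ?_
  simpa [algebraMap_eq] using h1

lemma MvPolynomial.vanishingIdeal_eq_span (x : Fin 2 → k) :
    vanishingIdeal k {x} = Ideal.span {X 0 - C (x 0), X 1 - C (x 1)} := by
  refine le_antisymm (fun g hg ↦ ?_) ?_
  · set I : Ideal (MvPolynomial (Fin 2) k) := Ideal.span {X 0 - C (x 0), X 1 - C (x 1)}
    have key : (Ideal.Quotient.mkₐ k I).comp (aeval fun i ↦ C (x i)) =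
        Ideal.Quotient.mkₐ k I := by
      refine algHom_ext fun i ↦ ?_
      rw [AlgHom.comp_apply, aeval_X, Ideal.Quotient.mkₐ_eq_mk, eq_comm, Ideal.Quotient.eq]
      fin_cases i <;> exact Ideal.subset_span (by simp)
    have h1 : aeval (fun i ↦ (C (x i) : MvPolynomial (Fin 2) k)) g = C (aeval x g) := by
      have : (aeval fun i ↦ (C (x i) : MvPolynomial (Fin 2) k)) =
          (Algebra.ofId k (MvPolynomial (Fin 2) k)).comp (aeval x) :=
        algHom_ext fun i ↦ by simp [Algebra.ofId_apply, algebraMap_eq]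
      rw [this]; rfl
    rw [mem_vanishingIdeal_singleton_iff] at hg
    have := DFunLike.congr_fun key g
    rw [AlgHom.comp_apply, h1, hg, map_zero, map_zero] at this
    exact Ideal.Quotient.eq_zero_iff_mem.mp this.symm
  · rw [Ideal.span_le]
    rintro _ (rfl | rfl) <;> simp

/-- Otherwise 0 < (f) < p < m would be a chain of length three in a ring of dimension two. -/
lemma MvPolynomial.isMaximal_of_span_lt {p : Ideal (MvPolynomial (Fin 2) k)} [p.IsPrime]
    {f : MvPolynomial (Fin 2) k} (hf : Prime f) (hlt : Ideal.span {f} < p) : p.IsMaximal := by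
  obtain ⟨m, hm, hpm⟩ := p.exists_le_maximal (Ideal.IsPrime.ne_top ‹_›)
  rcases hpm.eq_or_lt with rfl | hlt'
  · exact hm
  exfalso
  have hfp := (Ideal.span_singleton_prime hf.ne_zero).mpr hf
  have hbot : (⊥ : Ideal (MvPolynomial (Fin 2) k)).IsPrime := Ideal.isPrime_bot
  let s : LTSeries (PrimeSpectrum (MvPolynomial (Fin 2) k)) :=
    { length := 3
      toFun := ![⟨⊥, hbot⟩, ⟨_, hfp⟩, ⟨p, ‹_›⟩, ⟨m, hm.isPrime⟩]
      step := fun i ↦ by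
        fin_cases i
        · exact bot_lt_iff_ne_bot.mpr fun h0 ↦
            hf.ne_zero (Ideal.span_singleton_eq_bot.mp h0)
        · exact hlt
        · exact hlt' }
  have h1 : ((3 : ℕ) : WithBot ℕ∞) ≤ ringKrullDim (MvPolynomial (Fin 2) k) :=
    Order.LTSeries.length_le_krullDim s
  rw [MvPolynomial.ringKrullDim_of_isNoetherianRing, ringKrullDim_eq_zero_of_field] at h1
  simp only [zero_add, Nat.card_eq_fintype_card, Fintype.card_fin] at h1
  norm_cast at h1

end Plane

section Etale

variable {B A : Type*} [CommRing B] [CommRing A] [Algebra B A] [Algebra.Etale B A]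
  (q : Ideal A) [q.IsPrime]

/-- Unramifiedness lets generators of the contracted prime generate the maximal ideal upstairs;
flatness then keeps regular sequences regular. -/
lemma map_under_eq_maximalIdeal_of_etale :
    (q.under B).map (algebraMap B (Localization.AtPrime q)) =
      maximalIdeal (Localization.AtPrime q) := by
  let := Localization.AtPrime.algebraOfLiesOver (q.under B) q
  have : Algebra.IsUnramifiedAt B q :=
    Algebra.FormallyUnramified.comp _ A _
  exact ((Algebra.isUnramifiedAt_iff_map_eq B (q.under B) q).mp this).2

lemma flat_localization_of_etale : Module.Flat B (Localization.AtPrime q) :=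
  have : Module.Flat A (Localization.AtPrime q) := IsLocalization.flat _ q.primeCompl
  .trans B A _

lemma isRegularParameter_of_etale {a : B} (ha : IsSMulRegular B a)
    (hq : q.under B = Ideal.span {a}) :
    IsRegularParameter (algebraMap B (Localization.AtPrime q) a) where
  isSMulRegular := by
    have := flat_localization_of_etale (B := B) q
    have h := RingTheory.Sequence.IsWeaklyRegular.of_flat (S := Localization.AtPrime q)
      ((RingTheory.Sequence.isWeaklyRegular_singleton_iff B a).mpr ha)
    exact (RingTheory.Sequence.isWeaklyRegular_singleton_iff _ _).mp h
  maximalIdeal_eq := by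
    rw [← map_under_eq_maximalIdeal_of_etale (B := B), hq, Ideal.map_span, Set.image_singleton]

lemma isWeaklyRegular_pair_iff {R : Type*} [CommRing R] (a b : R) :
    RingTheory.Sequence.IsWeaklyRegular R [a, b] ↔
      IsSMulRegular R a ∧ ∀ c, a ∣ b * c → a ∣ c := by
  rw [RingTheory.Sequence.isWeaklyRegular_cons_iff,
    RingTheory.Sequence.isWeaklyRegular_singleton_iff]
  refine and_congr_right fun _ ↦ ?_
  rw [isSMulRegular_quotient_iff_mem_of_smul_mem]
  simp only [Submodule.mem_smul_pointwise_iff_exists, Submodule.mem_top, true_and, smul_eq_mul,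
    dvd_def, eq_comm]

lemma isRegularParameterPair_of_etale {a b : B} (ha : IsSMulRegular B a)
    (hb : ∀ c, a ∣ b * c → a ∣ c) (hq : q.under B = Ideal.span {a, b}) :
    IsRegularParameterPair (algebraMap B (Localization.AtPrime q) a)
      (algebraMap B (Localization.AtPrime q) b) := by
  have := flat_localization_of_etale (B := B) q
  have h := RingTheory.Sequence.IsWeaklyRegular.of_flat (S := Localization.AtPrime q)
    ((isWeaklyRegular_pair_iff a b).mpr ⟨ha, hb⟩)
  obtain ⟨h1, h2⟩ := (isWeaklyRegular_pair_iff _ _).mp h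
  refine ⟨h1, h2, ?_⟩
  rw [← map_under_eq_maximalIdeal_of_etale (B := B), hq, Ideal.map_span, Set.image_pair]

end Etale

section EtaleOverPlane

variable {A : Type*} [CommRing A] (q : Ideal A) [q.IsPrime]
  {k : Type*} [Field k] [IsAlgClosed k] [Algebra (MvPolynomial (Fin 2) k) A]
  [Algebra.Etale (MvPolynomial (Fin 2) k) A]

open MvPolynomial

lemma exists_isRegularParameterPair_of_isMaximal_under
    (h : (q.under (MvPolynomial (Fin 2) k)).IsMaximal) :
    ∃ a b : Localization.AtPrime q, IsRegularParameterPair a b := by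
  obtain ⟨x, hx⟩ := isMaximal_iff_eq_vanishingIdeal_singleton.mp h
  rw [vanishingIdeal_eq_span] at hx
  refine ⟨_, _, isRegularParameterPair_of_etale q ?_ (X_sub_C_dvd_of_dvd_mul _ _) hx⟩
  refine IsLeftRegular.isSMulRegular (IsRegular.of_ne_zero fun h0 ↦ ?_).left
  have := congrArg (coeff (Finsupp.single 0 1)) h0
  simp [coeff_C, Finsupp.single_eq_zero, eq_comm] at this

/-- The local rings of a smooth surface have regular systems of parameters. -/
lemma hasShortRegularSystem_of_etale (k : Type*) [Field k] [IsAlgClosed k]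
    [Algebra (MvPolynomial (Fin 2) k) A] [Algebra.Etale (MvPolynomial (Fin 2) k) A] :
    HasShortRegularSystem (Localization.AtPrime q) := by
  by_cases hbot : q.under (MvPolynomial (Fin 2) k) = ⊥
  · left
    rw [← map_under_eq_maximalIdeal_of_etale (B := MvPolynomial (Fin 2) k), hbot, Ideal.map_bot]
  -- A nonzero prime of the factorial ring k[x, y] contains a prime element f. It equals (f), or is
  -- strictly larger and then maximal.
  obtain ⟨f, hfq, hf⟩ := Ideal.IsPrime.exists_mem_prime_of_ne_bot
    (inferInstanceAs (q.under (MvPolynomial (Fin 2) k)).IsPrime) hbot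
  have hle : Ideal.span {f} ≤ q.under (MvPolynomial (Fin 2) k) := by
    rwa [Ideal.span_singleton_le_iff_mem]
  rcases hle.eq_or_lt with heq | hlt
  · right; left
    exact ⟨_, isRegularParameter_of_etale q
      (IsLeftRegular.isSMulRegular (IsRegular.of_ne_zero hf.ne_zero).left) heq.symm⟩
  · right; right
    exact exists_isRegularParameterPair_of_isMaximal_under q (isMaximal_of_span_lt hf hlt)

/-- The field A/q is of finite type over the Jacobson ring k[x, y], hence finite over it, so q
contracts to a maximal ideal. -/
lemma exists_isRegularParameterPair_of_isMaximal (k : Type*) [Field k] [IsAlgClosed k]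
    [Algebra (MvPolynomial (Fin 2) k) A] [Algebra.Etale (MvPolynomial (Fin 2) k) A]
    (hq : q.IsMaximal) :
    ∃ a b : Localization.AtPrime q, IsRegularParameterPair a b := by
  refine exists_isRegularParameterPair_of_isMaximal_under (k := k) q ?_
  let := Ideal.Quotient.field q
  have h1 : Module.Finite (MvPolynomial (Fin 2) k) (A ⧸ q) :=
    have : Algebra.FiniteType (MvPolynomial (Fin 2) k) (A ⧸ q) :=
      .of_surjective (Ideal.Quotient.mkₐ _ q) Ideal.Quotient.mk_surjective
    finite_of_finite_type_of_isJacobsonRing _ _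
  have h2 : q.under (MvPolynomial (Fin 2) k) =
      (⊥ : Ideal (A ⧸ q)).comap (algebraMap (MvPolynomial (Fin 2) k) (A ⧸ q)) := by
    rw [IsScalarTower.algebraMap_eq (MvPolynomial (Fin 2) k) A (A ⧸ q), ← Ideal.comap_comap]
    congr 1
    exact Ideal.mk_ker.symm
  rw [h2]
  exact Ideal.isMaximal_comap_of_isIntegral_of_isMaximal _

end EtaleOverPlane

lemma IsRegularParameterPair.bot_lt_lt {R : Type*} [CommRing R] [IsLocalRing R] {a b : R}
    (h : IsRegularParameterPair a b) : ⊥ < Ideal.span {a} ∧ Ideal.span {a} < maximalIdeal R := by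
  have ham : a ∈ maximalIdeal R := by
    rw [h.maximalIdeal_eq]; exact Ideal.subset_span (by simp)
  have hbm : b ∈ maximalIdeal R := by
    rw [h.maximalIdeal_eq]; exact Ideal.subset_span (by simp)
  refine ⟨bot_lt_iff_ne_bot.mpr fun h0 ↦ ?_, lt_of_le_of_ne ?_ fun h0 ↦ ?_⟩
  · rw [Ideal.span_singleton_eq_bot] at h0
    exact one_ne_zero (h.isSMulRegular (a₁ := (1 : R)) (a₂ := 0) (by simp [h0]))
  · rwa [Ideal.span_singleton_le_iff_mem]
  · rw [← h0, Ideal.mem_span_singleton] at hbm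
    have := isUnit_of_dvd_one (h.dvd_of_dvd_mul 1 (by rwa [mul_one]))
    exact (mem_maximalIdeal a).mp ham this

/-- A prime whose local ring is a field is the end of a chain of primes of length two starting
at any maximal ideal above it with a regular pair of parameters. -/
lemma exists_prime_lt_lt_of_maximalIdeal_eq_bot {A : Type*} [CommRing A] [IsNoetherianRing A]
    {w c : Ideal A} [w.IsPrime] [c.IsPrime] (hwc : w ≤ c)
    (hw : maximalIdeal (Localization.AtPrime w) = ⊥)
    (hc : ∃ a b : Localization.AtPrime c, IsRegularParameterPair a b) :
    ∃ z : Ideal A, z.IsPrime ∧ w < z ∧ z < c := by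
  obtain ⟨a, b, h⟩ := hc
  have := h.isDomain
  have hprime := h.isPrime
  obtain ⟨h1, h2⟩ := h.bot_lt_lt
  let φ := algebraMap A (Localization.AtPrime c)
  -- As the local ring at w is a field and the one at c is a domain, w is the contraction of zero.
  -- The intermediate prime will be the contraction of (a).
  have hwe : w = (⊥ : Ideal (Localization.AtPrime c)).comap φ := by
    ext x
    rw [Ideal.mem_comap, Ideal.mem_bot, IsLocalization.map_eq_zero_iff c.primeCompl]
    constructor
    · intro hx
      have hx0 : algebraMap A (Localization.AtPrime w) x = 0 := by
        rw [← Ideal.mem_bot, ← hw]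
        exact (IsLocalization.AtPrime.to_map_mem_maximal_iff (Localization.AtPrime w) w x).mpr hx
      obtain ⟨⟨u, hu⟩, hux⟩ := (IsLocalization.map_eq_zero_iff w.primeCompl _ x).mp hx0
      have : φ u * φ x = 0 := by rw [← map_mul]; exact (congrArg φ hux).trans (map_zero φ)
      rcases mul_eq_zero.mp this with h | h
      · obtain ⟨⟨v, hv⟩, hvu⟩ := (IsLocalization.map_eq_zero_iff c.primeCompl _ u).mp h
        exfalso
        have hvu' : v * u ∈ w := by rw [show v * u = 0 from hvu]; exact w.zero_mem
        rcases Ideal.IsPrime.mem_or_mem ‹w.IsPrime› hvu' with h | h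
        · exact hv (hwc h)
        · exact hu h
      · exact (IsLocalization.map_eq_zero_iff c.primeCompl _ x).mp h
    · rintro ⟨⟨v, hv⟩, hvx⟩
      have hvx' : v * x ∈ w := by rw [show v * x = 0 from hvx]; exact w.zero_mem
      exact (Ideal.IsPrime.mem_or_mem ‹w.IsPrime› hvx').resolve_left fun h ↦ hv (hwc h)
  have hce : c = (maximalIdeal (Localization.AtPrime c)).comap φ :=
    (IsLocalization.AtPrime.under_maximalIdeal (Localization.AtPrime c) c).symm
  have hinj : Function.Injective (Ideal.comap φ) :=
    (IsLocalization.orderEmbedding c.primeCompl (Localization.AtPrime c)).injective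
  have hmono {I J : Ideal (Localization.AtPrime c)} (hIJ : I < J) : I.comap φ < J.comap φ :=
    lt_of_le_of_ne (Ideal.comap_mono hIJ.le) fun h ↦ hIJ.ne (hinj h)
  refine ⟨(Ideal.span {a}).comap φ, inferInstance, ?_, ?_⟩
  · conv_lhs => rw [hwe]
    exact hmono h1
  · conv_rhs => rw [hce]
    exact hmono h2

end LocalAlgebra

/-! ### Tor₁ of presheaves as a kernel. -/

namespace CategoryTheory.Functor

/-- The first left derived functor of a right exact functor is the kernel of the image of a
syzygy inclusion. -/
lemma exists_leftDerived_one_iso_kernel {C D : Type*} [Category* C] [Category* D] [Abelian C]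
    [HasProjectiveResolutions C] [Abelian D] (F : C ⥤ D) [F.Additive] [PreservesFiniteColimits F]
    (X : C) : ∃ (K P : C) (d : K ⟶ P) (π : P ⟶ X) (w : d ≫ π = 0),
      (ShortComplex.mk d π w).ShortExact ∧ Projective P ∧
      Nonempty ((F.leftDerived 1).obj X ≅ Limits.kernel (F.map d)) := by
  let R := projectiveResolution X
  let a := R.complex.d 2 1
  let b := R.complex.d 1 0
  let π : R.complex.X 0 ⟶ X := R.π.f 0
  have hab : a ≫ b = 0 := R.complex.d_comp_d 2 1 0
  have hex : (ShortComplex.mk a b hab).Exact := R.exact_succ 0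
  let d : cokernel a ⟶ R.complex.X 0 := cokernel.desc a b hab
  have hcd : cokernel.π a ≫ d = b := cokernel.π_desc _ _ _
  have hd : Mono d := hex.mono_cokernelDesc
  have hbπ : b ≫ π = 0 := R.complex_d_comp_π_f_zero
  have hdπ : d ≫ π = 0 := by
    rw [← cancel_epi (cokernel.π a), reassoc_of% hcd, hbπ, comp_zero]
  have hπ : Epi π := inferInstanceAs (Epi (R.π.f 0))
  refine ⟨_, _, d, π, hdπ, ?_, inferInstanceAs (Projective (R.complex.X 0)), ?_⟩
  · refine { exact := ?_, mono_f := hd, epi_g := hπ }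
    have h0 : (ShortComplex.mk b π hbπ).Exact := R.exact₀
    let φ : ShortComplex.mk b π hbπ ⟶ ShortComplex.mk d π hdπ :=
      { τ₁ := cokernel.π a
        τ₂ := 𝟙 _
        τ₃ := 𝟙 _
        comm₁₂ := by simp [hcd]
        comm₂₃ := (Category.id_comp _).trans (Category.comp_id _).symm }
    have : Epi φ.τ₁ := inferInstanceAs (Epi (cokernel.π a))
    have : IsIso φ.τ₂ := inferInstanceAs (IsIso (𝟙 _))
    have : Mono φ.τ₃ := inferInstanceAs (Mono (𝟙 _))
    exact (ShortComplex.exact_iff_of_epi_of_isIso_of_mono φ).mp h0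
  · let G := (F.mapHomologicalComplex (ComplexShape.down ℕ)).obj R.complex
    have hac : F.map a ≫ F.map (cokernel.π a) = 0 := by
      rw [← F.map_comp, cokernel.condition, F.map_zero]
    -- By right exactness, F of the cokernel of P₂ → P₁ is the cokernel of F(P₂) → F(P₁). Hence the
    -- homology at F(P₁) is the kernel of the map from it to F(P₀).
    have hp : IsColimit (CokernelCofork.ofπ (f := F.map a) (F.map (cokernel.π a)) hac) :=
      CokernelCofork.mapIsColimit (CokernelCofork.ofπ (cokernel.π a) (cokernel.condition a))
        (cokernelIsCokernel a) F
    have hFab : F.map a ≫ F.map b = 0 := by rw [← F.map_comp, hab, F.map_zero]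
    let T : ShortComplex D := ShortComplex.mk (F.map a) (F.map b) hFab
    have hdesc : hp.desc (CokernelCofork.ofπ (F.map b) hFab) = F.map d := by
      refine Cofork.IsColimit.hom_ext hp ?_
      rw [Cofork.IsColimit.π_desc]
      change F.map b = F.map (cokernel.π a) ≫ F.map d
      rw [← F.map_comp, hcd]
    let H : T.RightHomologyData :=
      { Q := F.obj (cokernel a)
        H := Limits.kernel (F.map d)
        p := F.map (cokernel.π a)
        ι := kernel.ι (F.map d)
        wp := hac
        hp := hp
        wι := by
          change _ ≫ hp.desc (CokernelCofork.ofπ (F.map b) hFab) = 0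
          rw [hdesc, kernel.condition]
        hι := by
          refine KernelFork.IsLimit.ofι' _ _ fun {A} k hk ↦ ⟨kernel.lift _ k ?_, kernel.lift_ι _ _ _⟩
          rw [← hdesc]
          exact hk }
    exact ⟨R.isoLeftDerivedObj F 1 ≪≫
      ShortComplex.homologyMapIso (G.isoSc' 2 1 0 (by simp) (by simp)) ≪≫ H.homologyIso⟩

end CategoryTheory.Functor

namespace PresheafOfModules

instance preservesFiniteColimits_tensorLeft {C : Type u} [SmallCategory.{u} C]
    {R : Cᵒᵖ ⥤ CommRingCat.{u}}
    (M : PresheafOfModules.{u} (R ⋙ forget₂ CommRingCat RingCat)) :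
    PreservesFiniteColimits ((tensoringLeft _).obj M) where
  preservesFiniteColimits _ _ _ := ⟨⟨fun hc ↦
    ⟨evaluationJointlyReflectsColimits _ _ fun U ↦
      isColimitOfPreserves (tensorLeft (C := ModuleCat (R.obj U)) (M.obj U))
        (isColimitOfPreserves (evaluation _ U) hc)⟩⟩⟩

variable {C : Type u} [SmallCategory.{u} C] {R : Cᵒᵖ ⥤ RingCat.{u}}

instance projective_freeYonedaCoproduct_obj (M : PresheafOfModules.{u} R) (U : Cᵒᵖ) :
    Projective (M.freeYonedaCoproduct.obj U) := by
  have (m : M.Elements) : Projective ((evaluation R U).obj m.freeYoneda) :=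
    ModuleCat.projective_of_free (M := (ModuleCat.free (R.obj U)).obj _) Finsupp.basisSingleOne
  exact Projective.of_iso (PreservesCoproduct.iso (evaluation R U) _).symm inferInstance

/-- A projective presheaf is a retract of a coproduct of free presheaves on representables, whose
sections are projective. -/
lemma projective_obj (P : PresheafOfModules.{u} R) [Projective P] (U : Cᵒᵖ) :
    Projective (P.obj U) := by
  let s := Projective.factorThru (𝟙 P) P.fromFreeYonedaCoproduct
  have hs : s ≫ P.fromFreeYonedaCoproduct = 𝟙 P := Projective.factorThru_comp _ _
  exact Retract.projective (Y := P.freeYonedaCoproduct.obj U)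
    ⟨s.app U, P.fromFreeYonedaCoproduct.app U, congrArg (fun f ↦ (evaluation R U).map f) hs⟩

end PresheafOfModules

/-! ### Tensor products, flatness and Tor₁ in directed colimits. -/

section DirectedColimits

open TensorProduct Function

/-- A linear relation between pure tensors holds trivially once `m` is enlarged by finitely many
elements paired with zero. -/
lemma TensorProduct.exists_vanishesTrivially_sum_elim {R M N ι : Type*} [CommRing R]
    [AddCommGroup M] [Module R M] [AddCommGroup N] [Module R N] [Fintype ι] {m : ι → M} {n : ι → N}
    (h : ∑ i, m i ⊗ₜ[R] n i = 0) : ∃ (b : ℕ) (q : Fin b → M),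
      VanishesTrivially R (Sum.elim m q) (Sum.elim n 0) := by
  let P := Submodule.span R (Set.range m)
  have hm (i : ι) : m i ∈ P := Submodule.subset_span ⟨i, rfl⟩
  obtain ⟨Q, hPQ, hQ, h0⟩ := eq_zero_of_fg_of_subtype_eq_zero
    (t := ∑ i, (⟨m i, hm i⟩ : P) ⊗ₜ[R] n i) (Submodule.fg_span (Set.finite_range m)) (by
      simpa using h)
  obtain ⟨b, q, hq⟩ := Submodule.fg_iff_exists_fin_generating_family.mp hQ
  have hqQ (i : Fin b) : q i ∈ Q := hq ▸ Submodule.subset_span ⟨i, rfl⟩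
  let m' : ι ⊕ Fin b → Q := Sum.elim (fun i ↦ ⟨m i, hPQ (hm i)⟩) (fun i ↦ ⟨q i, hqQ i⟩)
  have hm' : Submodule.span R (Set.range m') = ⊤ := by
    apply Submodule.map_injective_of_injective Q.injective_subtype
    rw [Submodule.map_span, Submodule.map_top, Submodule.range_subtype, ← Set.range_comp]
    refine le_antisymm (Submodule.span_le.mpr ?_) ?_
    · rintro _ ⟨i, rfl⟩
      exact (m' i).2
    · refine hq.ge.trans ?_
      exact Submodule.span_mono (by rintro _ ⟨i, rfl⟩; exact ⟨Sum.inr i, rfl⟩)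
  -- The equational criterion needs a generating family on the left, so the generators of Q are
  -- added, paired with zero.
  obtain ⟨k, a, y, h₁, h₂⟩ := vanishesTrivially_of_sum_tmul_eq_zero R (m := m')
    (n := Sum.elim n 0) hm' (by simpa [m', Submodule.inclusion] using! h0)
  refine ⟨b, q, k, a, y, h₁, fun j ↦ ?_⟩
  have := congrArg Q.subtype (h₂ j)
  rw [map_sum, map_zero] at this
  rw [← this]
  refine Finset.sum_congr rfl fun i _ ↦ ?_
  cases i <;> rfl

variable {ι : Type*} [Preorder ι]

/-- `L` is the colimit of the directed system of abelian groups `A`. -/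
structure IsDirectedColimit {A : ι → Type*} [∀ i, AddCommGroup (A i)] {L : Type*} [AddCommGroup L]
    (σ : ∀ i j, i ≤ j → A i →+ A j) (c : ∀ i, A i →+ L) : Prop where
  map_map : ∀ i j l (hij : i ≤ j) (hjl : j ≤ l) x, σ j l hjl (σ i j hij x) = σ i l (hij.trans hjl) x
  map_self : ∀ i x, σ i i le_rfl x = x
  apply_map : ∀ i j (hij : i ≤ j) x, c j (σ i j hij x) = c i x
  exists_rep : ∀ y, ∃ i x, c i x = y
  exists_map_eq_zero : ∀ i x, c i x = 0 → ∃ j, ∃ hij : i ≤ j, σ i j hij x = 0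

namespace IsDirectedColimit

variable [IsDirectedOrder ι] {A : ι → Type*} [∀ i, AddCommGroup (A i)] {L : Type*} [AddCommGroup L]
  {σ : ∀ i j, i ≤ j → A i →+ A j} {c : ∀ i, A i →+ L}

lemma exists_rep_of_finite (h : IsDirectedColimit σ c) {κ : Type*} [Finite κ] (i₀ : ι)
    (y : κ → L) : ∃ i, ∃ _ : i₀ ≤ i, ∃ x : κ → A i, ∀ k, c i (x k) = y k := by
  choose i x hx using fun k ↦ h.exists_rep (y k)
  have : Nonempty ι := ⟨i₀⟩
  obtain ⟨j, hj⟩ := Finite.exists_le i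
  obtain ⟨l, hjl, hl⟩ := exists_ge_ge j i₀
  exact ⟨l, hl, fun k ↦ σ _ _ ((hj k).trans hjl) (x k), fun k ↦ by rw [h.apply_map, hx]⟩

lemma exists_map_eq_zero_of_finite (h : IsDirectedColimit σ c) {κ : Type*} [Finite κ] (i : ι)
    (x : κ → A i) (hx : ∀ k, c i (x k) = 0) : ∃ j, ∃ hij : i ≤ j, ∀ k, σ i j hij (x k) = 0 := by
  choose j hij hj using fun k ↦ h.exists_map_eq_zero i (x k) (hx k)
  have : Nonempty ι := ⟨i⟩
  obtain ⟨l, hl⟩ := Finite.exists_le j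
  obtain ⟨l', hll', hl'⟩ := exists_ge_ge l i
  exact ⟨l', hl', fun k ↦ by
    rw [← h.map_map _ _ _ (hij k) ((hl k).trans hll'), hj, map_zero]⟩

end IsDirectedColimit

/-- `L` is the colimit of the directed system of modules `A` over the directed system of rings `S`
with colimit `R`. -/
structure IsModuleColimit {S : ι → Type*} [∀ i, CommRing (S i)] {R : Type*} [CommRing R]
    (ρ : ∀ i j, i ≤ j → S i →+* S j) (r : ∀ i, S i →+* R)
    {A : ι → Type*} [∀ i, AddCommGroup (A i)] [∀ i, Module (S i) (A i)] {L : Type*}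
    [AddCommGroup L] [Module R L] (σ : ∀ i j, i ≤ j → A i →+ A j) (c : ∀ i, A i →+ L) : Prop extends
    IsDirectedColimit σ c where
  map_smul : ∀ i j h (s : S i) x, σ i j h (s • x) = ρ i j h s • σ i j h x
  apply_smul : ∀ i (s : S i) x, c i (s • x) = r i s • c i x

namespace IsModuleColimit

variable [IsDirectedOrder ι] {S : ι → Type*} [∀ i, CommRing (S i)] {R : Type*} [CommRing R]
  {ρ : ∀ i j, i ≤ j → S i →+* S j} {r : ∀ i, S i →+* R}
  {A : ι → Type*} [∀ i, AddCommGroup (A i)] [∀ i, Module (S i) (A i)] {L : Type*}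
  [AddCommGroup L] [Module R L] {σ : ∀ i j, i ≤ j → A i →+ A j} {c : ∀ i, A i →+ L}
  {A' : ι → Type*} [∀ i, AddCommGroup (A' i)] [∀ i, Module (S i) (A' i)] {L' : Type*}
  [AddCommGroup L'] [Module R L'] {σ' : ∀ i j, i ≤ j → A' i →+ A' j} {c' : ∀ i, A' i →+ L'}

/-- The comparison of the tensor product at one stage with the tensor product of the colimits. -/
noncomputable def tensorMap (h : IsModuleColimit ρ r σ c) (h' : IsModuleColimit ρ r σ' c') (i : ι) :
    A i ⊗[S i] A' i →+ L ⊗[R] L' :=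
  TensorProduct.liftAddHom
    (AddMonoidHom.mk' (fun m ↦ AddMonoidHom.mk' (fun n ↦ c i m ⊗ₜ[R] c' i n) fun n n' ↦ by
        rw [map_add, TensorProduct.tmul_add]) fun m m' ↦ by
      ext n
      simp [TensorProduct.add_tmul])
    fun s m n ↦ by
      simp [h.apply_smul, h'.apply_smul, TensorProduct.smul_tmul]

omit [IsDirectedOrder ι] in
@[simp]
lemma tensorMap_tmul (h : IsModuleColimit ρ r σ c) (h' : IsModuleColimit ρ r σ' c') (i : ι)
    (m : A i) (n : A' i) : h.tensorMap h' i (m ⊗ₜ n) = c i m ⊗ₜ c' i n :=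
  rfl

lemma exists_tensorMap_eq (h : IsModuleColimit ρ r σ c) (h' : IsModuleColimit ρ r σ' c')
    [Nonempty ι] (z : L ⊗[R] L') : ∃ i t, h.tensorMap h' i t = z := by
  obtain ⟨k, m, n, rfl⟩ := TensorProduct.exists_sum_tmul_eq z
  obtain ⟨i, -, x, hx⟩ := h.exists_rep_of_finite (Classical.arbitrary ι) m
  obtain ⟨j, hij, y, hy⟩ := h'.exists_rep_of_finite i n
  exact ⟨j, ∑ l, σ i j hij (x l) ⊗ₜ y l, by simp [h.apply_map, hx, hy]⟩

/-- A vanishing tensor in the colimit is witnessed by finitely many elements, scalars and equations.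
All of them lift to one stage, where they witness its vanishing. -/
lemma map_eq_zero_of_tensorMap_eq_zero (hS : IsDirectedColimit (fun i j h ↦ (ρ i j h : S i →+ S j))
      (fun i ↦ (r i : S i →+ R)))
    (h : IsModuleColimit ρ r σ c) (h' : IsModuleColimit ρ r σ' c')
    (τ : ∀ i j, i ≤ j → A i ⊗[S i] A' i →+ A j ⊗[S j] A' j)
    (hτ : ∀ i j hij m n, τ i j hij (m ⊗ₜ n) = σ i j hij m ⊗ₜ σ' i j hij n)
    (i : ι) (t : A i ⊗[S i] A' i) (ht : h.tensorMap h' i t = 0) :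
    ∃ j, ∃ hij : i ≤ j, τ i j hij t = 0 := by
  obtain ⟨k, m, n, rfl⟩ := TensorProduct.exists_sum_tmul_eq t
  simp only [map_sum, tensorMap_tmul] at ht
  obtain ⟨b, q, d, a, y, h₁, h₂⟩ := TensorProduct.exists_vanishesTrivially_sum_elim ht
  obtain ⟨i₁, hi₁, q', hq'⟩ := h.exists_rep_of_finite i q
  obtain ⟨i₂, hi₂, y', hy'⟩ := h'.exists_rep_of_finite i₁ y
  obtain ⟨i₃, hi₃, a', ha'⟩ := hS.exists_rep_of_finite i₂
    (fun p : (Fin k ⊕ Fin b) × Fin d ↦ a p.1 p.2)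
  let M : Fin k ⊕ Fin b → A i₃ := Sum.elim (fun l ↦ σ _ _ (hi₁.trans (hi₂.trans hi₃)) (m l))
    (fun l ↦ σ _ _ (hi₂.trans hi₃) (q' l))
  let N : Fin k ⊕ Fin b → A' i₃ := Sum.elim (fun l ↦ σ' _ _ (hi₁.trans (hi₂.trans hi₃)) (n l)) 0
  have hM (l) : c i₃ (M l) = Sum.elim (fun l ↦ c i (m l)) q l := by
    cases l <;> simp [M, h.apply_map, hq']
  have hN (l) : c' i₃ (N l) = Sum.elim (fun l ↦ c' i (n l)) 0 l := by
    cases l <;> simp [N, h'.apply_map]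
  have ha'' (p) : r i₃ (a' p) = a p.1 p.2 := ha' p
  obtain ⟨i₄, hi₄, e₁⟩ := h'.exists_map_eq_zero_of_finite i₃
    (fun l ↦ N l - ∑ j, a' (l, j) • σ' _ _ hi₃ (y' j)) (fun l ↦ by
      simp [hN, h₁, h'.apply_smul, ha'', h'.apply_map, hy'])
  obtain ⟨i₅, hi₅, e₂⟩ := h.exists_map_eq_zero_of_finite i₄
    (fun j ↦ σ _ _ hi₄ (∑ l, a' (l, j) • M l)) (fun j ↦ by
      simp [hM, h₂, h.apply_smul, ha'', h.apply_map, - Fintype.sum_sum_type])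
  refine ⟨i₅, hi₁.trans (hi₂.trans (hi₃.trans (hi₄.trans hi₅))), ?_⟩
  have key : ∑ l, σ _ _ (hi₄.trans hi₅) (M l) ⊗ₜ[S i₅] σ' _ _ (hi₄.trans hi₅) (N l) = 0 := by
    refine TensorProduct.sum_tmul_eq_zero_of_vanishesTrivially _ ⟨d,
      fun l j ↦ ρ _ _ (hi₄.trans hi₅) (a' (l, j)),
      fun j ↦ σ' _ _ (hi₃.trans (hi₄.trans hi₅)) (y' j), fun l ↦ ?_, fun j ↦ ?_⟩
    · have := congrArg (σ' _ _ hi₅) (e₁ l)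
      rw [h'.map_map, map_sub, map_zero, sub_eq_zero] at this
      simp [this, h'.map_smul, h'.map_map]
    · have := e₂ j
      rw [h.map_map, map_sum] at this
      simpa [h.map_smul, - Fintype.sum_sum_type] using this
  rw [Fintype.sum_sum_type] at key
  simpa [M, N, h.map_map, h'.map_map, hτ] using key

/-- By the equational criterion: a linear relation already holds at some stage, is trivial there by
flatness, and its trivialization maps to the colimit. -/
lemma flat (hS : IsDirectedColimit (fun i j h ↦ (ρ i j h : S i →+ S j))
      (fun i ↦ (r i : S i →+ R))) (h : IsModuleColimit ρ r σ c)
    [Nonempty ι] [∀ i, Module.Flat (S i) (A i)] : Module.Flat R L := by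
  refine Module.Flat.of_forall_isTrivialRelation fun {l f x} hfx ↦ ?_
  obtain ⟨i, -, x', hx'⟩ := h.exists_rep_of_finite (Classical.arbitrary ι) x
  obtain ⟨i₁, hi₁, f', hf'⟩ := hS.exists_rep_of_finite i f
  have hf'' (p) : r i₁ (f' p) = f p := hf' p
  obtain ⟨i₂, hi₂, e⟩ := h.exists_map_eq_zero i₁ (∑ p, f' p • σ _ _ hi₁ (x' p))
    (by simp [h.apply_smul, h.apply_map, hf'', hx', hfx])
  simp only [map_sum, h.map_smul, h.map_map] at e
  obtain ⟨k, a, y, h₁, h₂⟩ := Module.Flat.isTrivialRelation_of_sum_smul_eq_zero e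
  have hr (s) : r i₂ (ρ i₁ i₂ hi₂ s) = r i₁ s := hS.apply_map _ _ hi₂ s
  refine ⟨k, fun p j ↦ r i₂ (a p j), fun j ↦ c i₂ (y j), fun p ↦ ?_, fun j ↦ ?_⟩
  · have := congrArg (c i₂) (h₁ p)
    simpa [h.apply_map, hx', h.apply_smul] using this
  · have := congrArg (r i₂) (h₂ j)
    simpa [hr, hf''] using this

variable {K P N T : ι → Type*} [∀ i, AddCommGroup (K i)] [∀ i, AddCommGroup (P i)]
  [∀ i, AddCommGroup (N i)] [∀ i, AddCommGroup (T i)] [∀ i, Module (S i) (K i)]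
  [∀ i, Module (S i) (P i)] [∀ i, Module (S i) (N i)] [∀ i, Module (S i) (T i)]
  {K' P' N' T' : Type*} [AddCommGroup K'] [AddCommGroup P'] [AddCommGroup N'] [AddCommGroup T']
  [Module R K'] [Module R P'] [Module R N'] [Module R T']
  {σK : ∀ i j, i ≤ j → K i →+ K j} {σP : ∀ i j, i ≤ j → P i →+ P j}
  {σN : ∀ i j, i ≤ j → N i →+ N j} {σT : ∀ i j, i ≤ j → T i →+ T j}
  {cK : ∀ i, K i →+ K'} {cP : ∀ i, P i →+ P'} {cN : ∀ i, N i →+ N'} {cT : ∀ i, T i →+ T'}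

/-- `Tor₁` of two filtered colimits of modules vanishes if and only if the `Tor₁` at the
various stages, computed as kernels, vanish in the colimit. -/
theorem torOneVanishes_iff [Nonempty ι]
    (hS : IsDirectedColimit (fun i j h ↦ (ρ i j h : S i →+ S j)) (fun i ↦ (r i : S i →+ R)))
    (hK : IsModuleColimit ρ r σK cK) (hP : IsModuleColimit ρ r σP cP)
    (hN : IsModuleColimit ρ r σN cN) (hT : IsModuleColimit ρ r σT cT)
    (τ : ∀ i j, i ≤ j → T i ⊗[S i] K i →+ T j ⊗[S j] K j)
    (hτ : ∀ i j hij m n, τ i j hij (m ⊗ₜ n) = σT i j hij m ⊗ₜ σK i j hij n)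
    (τ' : ∀ i j, i ≤ j → T i ⊗[S i] P i →+ T j ⊗[S j] P j)
    (hτ' : ∀ i j hij m n, τ' i j hij (m ⊗ₜ n) = σT i j hij m ⊗ₜ σP i j hij n)
    [∀ i, Module.Flat (S i) (P i)]
    (d : ∀ i, K i →ₗ[S i] P i) (π : ∀ i, P i →ₗ[S i] N i) (d' : K' →ₗ[R] P') (π' : P' →ₗ[R] N')
    (hσd : ∀ i j hij x, σP i j hij (d i x) = d j (σK i j hij x))
    (hσπ : ∀ i j hij x, σN i j hij (π i x) = π j (σP i j hij x))
    (hcd : ∀ i x, cP i (d i x) = d' (cK i x)) (hcπ : ∀ i x, cN i (π i x) = π' (cP i x))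
    (hd : ∀ i, Injective (d i)) (hdπ : ∀ i, Exact (d i) (π i)) (hπ : ∀ i, Surjective (π i)) :
    TorOneVanishes R T' N' ↔ ∀ i (t : T i ⊗[S i] K i), (d i).lTensor (T i) t = 0 →
      ∃ j, ∃ hij : i ≤ j, τ i j hij t = 0 := by
  have : Module.Flat R P' := hP.flat hS
  have hd' : Injective d' := by
    rw [injective_iff_map_eq_zero]
    intro x hx
    obtain ⟨i, x, rfl⟩ := hK.exists_rep x
    rw [← hcd] at hx
    obtain ⟨j, hij, hj⟩ := hP.exists_map_eq_zero i _ hx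
    rw [hσd, map_eq_zero_iff _ (hd j)] at hj
    rw [← hK.apply_map i j hij, hj, map_zero]
  have hdπ' : Exact d' π' := by
    intro x
    obtain ⟨i, x, rfl⟩ := hP.exists_rep x
    constructor
    · intro hx
      rw [← hcπ] at hx
      obtain ⟨j, hij, hj⟩ := hN.exists_map_eq_zero i _ hx
      rw [hσπ] at hj
      obtain ⟨y, hy⟩ := (hdπ j _).mp hj
      exact ⟨cK j y, by rw [← hcd, hy, hP.apply_map]⟩
    · rintro ⟨y, hy⟩
      obtain ⟨j, y, rfl⟩ := hK.exists_rep y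
      rw [← hy, ← hcd, ← hcπ, (hdπ j).apply_apply_eq_zero, map_zero]
  have hπ' : Surjective π' := by
    intro x
    obtain ⟨i, x, rfl⟩ := hN.exists_rep x
    obtain ⟨y, rfl⟩ := hπ i x
    exact ⟨cP i y, (hcπ i y).symm⟩
  have hτd (i j hij) (t : T i ⊗[S i] K i) :
      τ' i j hij ((d i).lTensor (T i) t) = (d j).lTensor (T j) (τ i j hij t) := by
    induction t with
    | zero => simp
    | tmul x y => simp [hτ, hτ', hσd]
    | add x y hx hy => simp [hx, hy]
  have hγd (i) (t : T i ⊗[S i] K i) :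
      hT.tensorMap hP i ((d i).lTensor (T i) t) = d'.lTensor T' (hT.tensorMap hK i t) := by
    induction t with
    | zero => simp
    | tmul x y => simp [hcd]
    | add x y hx hy => simp [hx, hy]
  have hγτ (i j hij) (t : T i ⊗[S i] K i) :
      hT.tensorMap hK j (τ i j hij t) = hT.tensorMap hK i t := by
    induction t with
    | zero => simp
    | tmul x y => simp [hτ, hT.apply_map, hK.apply_map]
    | add x y hx hy => simp [hx, hy]
  rw [TorOneVanishes.iff_of_flat_right hd' hdπ' hπ']
  constructor
  · intro h i t ht
    refine map_eq_zero_of_tensorMap_eq_zero hS hT hK τ hτ i t (h ?_)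
    rw [← hγd, ht, map_zero, map_zero]
  · intro h
    rw [injective_iff_map_eq_zero]
    intro z hz
    obtain ⟨i, t, rfl⟩ := hT.exists_tensorMap_eq hK z
    rw [← hγd] at hz
    obtain ⟨j, hij, hj⟩ := map_eq_zero_of_tensorMap_eq_zero hS hT hP τ' hτ' i _ hz
    rw [hτd] at hj
    obtain ⟨l, hjl, hl⟩ := h j _ hj
    rw [← hγτ i j hij, ← hγτ j l hjl, hl, map_zero]

end IsModuleColimit

end DirectedColimits

namespace IsModuleColimit

variable {ι : Type*} [Preorder ι] [IsDirectedOrder ι] {S : ι → Type*} [∀ i, CommRing (S i)]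
  {R : Type*} [CommRing R]
  {ρ : ∀ i j, i ≤ j → S i →+* S j} {r : ∀ i, S i →+* R}
  {A : ι → Type*} [∀ i, AddCommGroup (A i)] [∀ i, Module (S i) (A i)] {L : Type*}
  [AddCommGroup L] [Module R L] {σ : ∀ i j, i ≤ j → A i →+ A j} {c : ∀ i, A i →+ L}
  {A' : ι → Type*} [∀ i, AddCommGroup (A' i)] [∀ i, Module (S i) (A' i)] {L' : Type*}
  [AddCommGroup L'] [Module R L'] {σ' : ∀ i j, i ≤ j → A' i →+ A' j} {c' : ∀ i, A' i →+ L'}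

lemma map_smul_of_comm
    (hS : IsDirectedColimit (fun i j h ↦ (ρ i j h : S i →+ S j)) (fun i ↦ (r i : S i →+ R)))
    (h : IsModuleColimit ρ r σ c) (h' : IsModuleColimit ρ r σ' c')
    (f : ∀ i, A i →ₗ[S i] A' i) (g : L →+ L') (hfg : ∀ i x, c' i (f i x) = g (c i x)) (s : R)
    (y : L) : g (s • y) = s • g y := by
  obtain ⟨i, s, rfl⟩ := hS.exists_rep s
  obtain ⟨j, hij, y', hy⟩ := h.exists_rep_of_finite i (fun _ : Unit ↦ y)
  rw [← hS.apply_map i j hij s, ← hy ()]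
  change g (r j (ρ i j hij s) • _) = r j (ρ i j hij s) • _
  rw [← h.apply_smul, ← hfg, _root_.map_smul, h'.apply_smul, hfg]

end IsModuleColimit

/-! ### Stalks of presheaves of modules and of Tor₁. -/

namespace PresheafOfModules

open TopologicalSpace TopCat.Presheaf TensorProduct

variable {X : TopCat.{u}} {R : X.Presheaf CommRingCat.{u}} (x : X)

/-- The open neighbourhoods of a point, ordered by reverse inclusion. -/
abbrev NhdsIndex (x : X) : Type u := {U : Opens X // x ∈ U}ᵒᵈ

namespace NhdsIndex

variable {x}

/-- The open set underlying an index. -/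
abbrev opens (i : NhdsIndex x) : Opens X := (OrderDual.ofDual i).1

lemma mem (i : NhdsIndex x) : x ∈ i.opens := (OrderDual.ofDual i).2

/-- The restriction along two comparable neighbourhoods. -/
abbrev res {i j : NhdsIndex x} (h : i ≤ j) : op i.opens ⟶ op j.opens :=
  (homOfLE (show j.opens ≤ i.opens from h)).op

instance : IsDirectedOrder (NhdsIndex x) where
  directed i j := ⟨OrderDual.toDual ⟨i.opens ⊓ j.opens, i.mem, j.mem⟩,
    (inf_le_left : i.opens ⊓ j.opens ≤ i.opens), (inf_le_right : i.opens ⊓ j.opens ≤ j.opens)⟩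

instance : Nonempty (NhdsIndex x) := ⟨OrderDual.toDual ⟨⊤, trivial⟩⟩

end NhdsIndex

lemma isDirectedColimit_stalk (F : X.Presheaf Ab.{u}) :
    IsDirectedColimit (fun (_ _ : NhdsIndex x) h ↦ (F.map (NhdsIndex.res h)).hom)
      (fun i ↦ (F.germ i.opens x i.mem).hom) where
  map_map _ _ _ _ _ y := by
    rw [← AddCommGrpCat.comp_apply, ← F.map_comp]
    rfl
  map_self i y := by
    change F.map (𝟙 _) y = y
    rw [F.map_id]
    rfl
  apply_map i j hij y := germ_res_apply F _ x _ y
  exists_rep y := by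
    obtain ⟨U, hU, s, hs⟩ := F.exists_germ_eq y
    exact ⟨OrderDual.toDual ⟨U, hU⟩, s, hs⟩
  exists_map_eq_zero i y hy := by
    obtain ⟨W, hW, iU, iV, e⟩ := F.germ_eq x i.mem i.mem y 0 (by rw [hy, map_zero])
    exact ⟨OrderDual.toDual ⟨W, hW⟩, iU.le, e.trans (map_zero _)⟩

lemma isDirectedColimit_stalk_ring :
    IsDirectedColimit (fun (i j : NhdsIndex x) h ↦
        ((R.map (NhdsIndex.res h)).hom : R.obj (op i.opens) →+ R.obj (op j.opens)))
      (fun i ↦ ((R.germ i.opens x i.mem).hom : R.obj (op i.opens) →+ R.stalk x)) where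
  map_map _ _ _ _ _ y := by
    change R.map _ (R.map _ y) = R.map _ y
    rw [← CommRingCat.comp_apply, ← R.map_comp]
    rfl
  map_self i y := by
    change R.map (𝟙 _) y = y
    rw [R.map_id]
    rfl
  apply_map i j hij y := germ_res_apply R _ x _ y
  exists_rep y := by
    obtain ⟨U, hU, s, hs⟩ := R.exists_germ_eq y
    exact ⟨OrderDual.toDual ⟨U, hU⟩, s, hs⟩
  exists_map_eq_zero i y hy := by
    obtain ⟨W, hW, iU, iV, e⟩ := R.germ_eq x i.mem i.mem y 0 (hy.trans (map_zero _).symm)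
    exact ⟨OrderDual.toDual ⟨W, hW⟩, iU.le, e.trans (map_zero _)⟩

variable (M N : PresheafOfModules.{u} (R ⋙ forget₂ CommRingCat RingCat))

/-- Sections over the neighbourhoods of a point, as modules over the sections of `R`. -/
abbrev Sec (i : NhdsIndex x) : Type u := M.obj (op i.opens)

lemma isModuleColimit_stalk :
    IsModuleColimit (S := fun i : NhdsIndex x ↦ R.obj (op i.opens)) (A := Sec x M)
      (R := R.stalk x) (L := ↑(TopCat.Presheaf.stalk M.presheaf x))
      (fun _ _ h ↦ (R.map (NhdsIndex.res h)).hom) (fun i ↦ (R.germ i.opens x i.mem).hom)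
      (fun _ _ h ↦ (M.presheaf.map (NhdsIndex.res h)).hom)
      (fun i ↦ (TopCat.Presheaf.germ M.presheaf i.opens x i.mem).hom) where
  toIsDirectedColimit := isDirectedColimit_stalk x M.presheaf
  map_smul _ _ _ s y := M.map_smul _ s y
  apply_smul _ s y := germ_smul M x _ _ s y

variable {M N} in
/-- A morphism of presheaves of modules induces a linear map on stalks. -/
noncomputable def stalkMap (f : M ⟶ N) :
    ↑(TopCat.Presheaf.stalk M.presheaf x) →ₗ[R.stalk x] ↑(TopCat.Presheaf.stalk N.presheaf x) where
  __ := ((stalkFunctor Ab x).map ((toPresheaf _).map f)).hom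
  map_smul' r m := IsModuleColimit.map_smul_of_comm (isDirectedColimit_stalk_ring x)
    (isModuleColimit_stalk x M) (isModuleColimit_stalk x N)
    (fun i ↦ (f.app (op i.opens)).hom)
    ((stalkFunctor Ab x).map ((toPresheaf _).map f)).hom
    (fun _ m ↦ (stalkFunctor_map_germ_apply _ _ _ ((toPresheaf _).map f) m).symm) r m

variable {M N} in
lemma stalkMap_germ (f : M ⟶ N) (i : NhdsIndex x) (m : Sec x M i) :
    stalkMap x f (TopCat.Presheaf.germ M.presheaf i.opens x i.mem m) =
      TopCat.Presheaf.germ N.presheaf i.opens x i.mem (f.app _ m) :=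
  stalkFunctor_map_germ_apply _ _ _ ((toPresheaf _).map f) m

variable {M N} in
/-- Vanishing of `Tor₁` on stalks, tested on a flat resolution of presheaves. -/
lemma torOneVanishes_stalk_iff (T : PresheafOfModules.{u} (R ⋙ forget₂ CommRingCat RingCat))
    {K P : PresheafOfModules.{u} (R ⋙ forget₂ CommRingCat RingCat)} (d : K ⟶ P) (π : P ⟶ N)
    (w : d ≫ π = 0) (h : (ShortComplex.mk d π w).ShortExact) [Projective P] :
    TorOneVanishes (R.stalk x) ↑(TopCat.Presheaf.stalk T.presheaf x)
        ↑(TopCat.Presheaf.stalk N.presheaf x) ↔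
      ∀ (i : NhdsIndex x) (t : (T ⊗ K : PresheafOfModules _).obj (op i.opens)),
        (T ◁ d).app _ t = 0 → ∃ j, ∃ hij : i ≤ j, (T ⊗ K).map (NhdsIndex.res hij) t = 0 := by
  have hU (U) : ((ShortComplex.mk d π w).map (evaluation _ U)).ShortExact :=
    h.map_of_exact (evaluation _ U)
  have (i : NhdsIndex x) : Module.Flat (R.obj (op i.opens)) (Sec x P i) := by
    have := projective_obj P (op i.opens)
    have : Module.Projective (R.obj (op i.opens)) (Sec x P i) :=
      (IsProjective.iff_projective _).mpr this
    infer_instance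
  exact IsModuleColimit.torOneVanishes_iff (isDirectedColimit_stalk_ring x)
    (isModuleColimit_stalk x K) (isModuleColimit_stalk x P) (isModuleColimit_stalk x N)
    (isModuleColimit_stalk x T)
    (fun i j hij ↦ ((T ⊗ K : PresheafOfModules _).presheaf.map (NhdsIndex.res hij)).hom)
    (fun i j hij m n ↦ rfl)
    (fun i j hij ↦ ((T ⊗ P : PresheafOfModules _).presheaf.map (NhdsIndex.res hij)).hom)
    (fun i j hij m n ↦ rfl)
    (fun i ↦ (d.app (op i.opens)).hom) (fun i ↦ (π.app (op i.opens)).hom)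
    (stalkMap x d) (stalkMap x π)
    (fun i j hij y ↦ (naturality_apply d (NhdsIndex.res hij) y).symm)
    (fun i j hij y ↦ (naturality_apply π (NhdsIndex.res hij) y).symm)
    (fun i y ↦ (stalkMap_germ x d i y).symm) (fun i y ↦ (stalkMap_germ x π i y).symm)
    (fun i ↦ (ModuleCat.mono_iff_injective _).mp (hU _).mono_f)
    (fun i ↦ (ShortComplex.ShortExact.moduleCat_exact_iff_function_exact _).mp (hU _).exact)
    (fun i ↦ (ModuleCat.epi_iff_surjective _).mp (hU _).epi_g)

lemma subsingleton_stalk_iff :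
    Subsingleton ↑(TopCat.Presheaf.stalk M.presheaf x) ↔
      ∀ (i : NhdsIndex x) (t : M.obj (op i.opens)), ∃ j, ∃ hij : i ≤ j,
        M.map (NhdsIndex.res hij) t = 0 := by
  constructor
  · intro h i t
    exact (isModuleColimit_stalk x M).exists_map_eq_zero i t (Subsingleton.elim _ _)
  · refine fun h ↦ subsingleton_of_forall_eq 0 fun y ↦ ?_
    obtain ⟨i, t, rfl⟩ := (isModuleColimit_stalk x M).exists_rep y
    obtain ⟨j, hij, hj⟩ := h i t
    rw [← (isModuleColimit_stalk x M).apply_map i j hij]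
    exact (congrArg _ hj).trans (map_zero _)

/-- The stalks of the presheaf `Tor₁` vanish exactly where `Tor₁` of the stalks does. -/
theorem subsingleton_stalk_tor_iff :
    Subsingleton ↑(TopCat.Presheaf.stalk (((Tor (PresheafOfModules.{u}
      (R ⋙ forget₂ CommRingCat RingCat)) 1).obj M).obj N).presheaf x) ↔
    TorOneVanishes (R.stalk x) ↑(TopCat.Presheaf.stalk M.presheaf x)
        ↑(TopCat.Presheaf.stalk N.presheaf x) := by
  obtain ⟨K, P, d, π, w, h, hP, ⟨e⟩⟩ :=
    Functor.exists_leftDerived_one_iso_kernel ((tensoringLeft _).obj M) N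
  replace e : ((Tor (PresheafOfModules.{u}
      (R ⋙ forget₂ CommRingCat RingCat)) 1).obj M).obj N ≅ kernel (M ◁ d) := e
  have he := ((stalkFunctor Ab x).mapIso ((toPresheaf _).mapIso e)).addCommGroupIsoToAddEquiv
  rw [torOneVanishes_stalk_iff x M d π w h]
  refine he.toEquiv.subsingleton_congr.trans ((subsingleton_stalk_iff x (kernel (M ◁ d))).trans ?_)
  have hι (U) : Function.Injective ((kernel.ι (M ◁ d)).app U) :=
    (ModuleCat.mono_iff_injective _).mp (inferInstanceAs (Mono ((evaluation _ U).map _)))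
  constructor
  · intro hF i t ht
    have hex := ((ShortComplex.exact_kernel (M ◁ d)).map (evaluation _ (op i.opens)))
    obtain ⟨s, rfl⟩ := (ShortComplex.moduleCat_exact_iff _).mp hex t ht
    obtain ⟨j, hij, hj⟩ := hF i s
    exact ⟨j, hij, (naturality_apply (kernel.ι (M ◁ d)) (NhdsIndex.res hij) s).symm.trans
      ((congrArg _ hj).trans (map_zero _))⟩
  · intro hF i s
    obtain ⟨j, hij, hj⟩ := hF i ((kernel.ι (M ◁ d)).app _ s)
      (congr((($(kernel.condition (M ◁ d))).app (op i.opens)) s))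
    exact ⟨j, hij, hι _ (((naturality_apply (kernel.ι (M ◁ d)) (NhdsIndex.res hij) s).trans
      hj).trans (map_zero _).symm)⟩

end PresheafOfModules

/-! ### From the Tor sheaf to Tor₁ of stalks. -/

namespace AlgebraicGeometry.Scheme.Modules

variable {X : Scheme.{u}}

lemma eq_zero_of_subsingleton_stalk (M : X.Modules)
    (h : ∀ x, Subsingleton ↑(M.presheaf.stalk x)) {U : X.Opens} (s : Γ(M, U)) : s = 0 :=
  TopCat.Presheaf.section_ext ⟨M.presheaf, SheafOfModules.isSheaf M⟩ U s 0 fun x _ ↦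
    (h x).elim _ _

lemma isZero_iff_subsingleton_stalk (M : X.Modules) :
    IsZero M ↔ ∀ x, Subsingleton ↑(M.presheaf.stalk x) := by
  rw [IsZero.iff_id_eq_zero]
  constructor
  · refine fun h x ↦ subsingleton_of_forall_eq 0 fun y ↦ ?_
    obtain ⟨U, hU, s, rfl⟩ := TopCat.Presheaf.exists_germ_eq M.presheaf y
    have hs : s = 0 := congr((($h).app U) s)
    rw [hs, map_zero]
  · intro h
    ext U s
    exact eq_zero_of_subsingleton_stalk M h _

lemma subsingleton_stalk_sheafification (M : X.PresheafOfModules) (x : X) :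
    Subsingleton ↑(TopCat.Presheaf.stalk (presheaf
      ((_root_.PresheafOfModules.sheafification (𝟙 X.ringCatSheaf.obj)).obj M)) x) ↔
      Subsingleton ↑(TopCat.Presheaf.stalk M.presheaf x) := by
  have : IsIso ((TopCat.Presheaf.stalkFunctor Ab x).map (CategoryTheory.toSheafify
      (Opens.grothendieckTopology X) M.presheaf)) :=
    TopCat.Presheaf.stalkFunctor_map_unit_toSheafify_isIso x Ab M.presheaf
  exact (asIso ((TopCat.Presheaf.stalkFunctor Ab x).map (CategoryTheory.toSheafify
    (Opens.grothendieckTopology X) M.presheaf))).addCommGroupIsoToAddEquiv.symm.toEquiv.subsingleton_congr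

/-- `𝒯or₁` is nonzero if and only if `Tor₁` of the stalks is nonzero somewhere. -/
theorem not_isZero_torSheaf_one_iff (M N : X.Modules) :
    ¬ IsZero (torSheaf 1 M N) ↔
      ∃ x, ¬ TorOneVanishes (X.presheaf.stalk x) (M.presheaf.stalk x) (N.presheaf.stalk x) := by
  rw [isZero_iff_subsingleton_stalk, not_forall]
  refine exists_congr fun x ↦ not_congr ?_
  exact (subsingleton_stalk_sheafification _ x).trans
    (_root_.PresheafOfModules.subsingleton_stalk_tor_iff (R := X.presheaf) x M.val N.val)

end AlgebraicGeometry.Scheme.Modules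

/-! ### Stalks as localizations of sections over an affine chart. -/

namespace AlgebraicGeometry.Scheme.Modules

variable {A : CommRingCat.{u}} {X : Scheme.{u}} (j : Spec A ⟶ X) [IsOpenImmersion j] (y : Spec A)

instance isPrime_asIdeal : (PrimeSpectrum.asIdeal y).IsPrime := PrimeSpectrum.isPrime y

/-- The sections over an affine chart acting on the stalk at a point of the chart. -/
noncomputable def chartRingHom : A →+* X.presheaf.stalk (j y) :=
  ((Scheme.ΓSpecIso A).inv ≫ (j.appIso ⊤).inv ≫
    X.presheaf.germ (j ''ᵁ ⊤) (j y) ⟨y, trivial, rfl⟩).hom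

lemma chartRingHom_eq (V : (Spec A).Opens) (hy : y ∈ V) (r : A) :
    chartRingHom j y r = X.presheaf.germ (j ''ᵁ V) (j y) ⟨y, hy, rfl⟩ ((j.appIso V).inv
      ((Spec A).presheaf.map V.leTop.op ((Scheme.ΓSpecIso A).inv r))) := by
  have h := Scheme.Hom.appIso_inv_naturality j V.leTop.op
  have h' : (Scheme.ΓSpecIso A).inv ≫ (Spec A).presheaf.map V.leTop.op ≫ (j.appIso V).inv ≫
      X.presheaf.germ (j ''ᵁ V) (j y) ⟨y, hy, rfl⟩ = (Scheme.ΓSpecIso A).inv ≫ (j.appIso ⊤).inv ≫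
    X.presheaf.germ (j ''ᵁ ⊤) (j y) ⟨y, trivial, rfl⟩ := by
    rw [reassoc_of% h]
    congr 2
    exact X.presheaf.germ_res _ _ _
  exact congr($(h'.symm) r)

lemma stalkMap_chartRingHom (r : A) :
    j.stalkMap y (chartRingHom j y r) = StructureSheaf.toStalk A y r := by
  have h := Scheme.Hom.germ_stalkMap j (j ''ᵁ ⊤) y ⟨y, trivial, rfl⟩
  have h' : (Scheme.ΓSpecIso A).inv ≫ (j.appIso ⊤).inv ≫
      X.presheaf.germ (j ''ᵁ ⊤) (j y) ⟨y, trivial, rfl⟩ ≫ j.stalkMap y =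
      (Scheme.ΓSpecIso A).inv ≫ (Spec A).presheaf.germ ⊤ y trivial := by
    rw [h, Scheme.Hom.appIso_inv_app_assoc]
    congr 1
    exact (Spec A).presheaf.germ_res _ _ _
  exact congr($h' r)

/-- The stalk as an algebra over the coordinate ring of a chart. -/
noncomputable abbrev chartAlgebra : Algebra A (X.presheaf.stalk (j y)) :=
  (chartRingHom j y).toAlgebra

lemma isLocalization_chart :
    letI := chartAlgebra j y
    IsLocalization.AtPrime (X.presheaf.stalk (j y)) (PrimeSpectrum.asIdeal y) := by
  let := chartAlgebra j y
  let e : (X.presheaf.stalk (j y)) ≃+* (Spec A).presheaf.stalk y :=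
    (asIso (j.stalkMap y)).commRingCatIsoToRingEquiv
  let : Algebra A ((Spec A).presheaf.stalk y) := StructureSheaf.stalkAlgebra A y
  have : IsLocalization.AtPrime ((Spec A).presheaf.stalk y) (PrimeSpectrum.asIdeal y) :=
    StructureSheaf.IsLocalization.to_stalk A y
  refine IsLocalization.isLocalization_of_algEquiv (PrimeSpectrum.asIdeal y).primeCompl
    (S := (Spec A).presheaf.stalk y) (AlgEquiv.ofRingEquiv (f := e.symm) fun r ↦ ?_)
  rw [RingEquiv.symm_apply_eq]
  exact (stalkMap_chartRingHom j y r).symm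

variable (M : X.Modules)

/-- The sections of a sheaf of modules over a chart. -/
abbrev ChartSections : Type u := Γ(M.restrict j, ⊤)

/-- The stalk of a sheaf of modules as a module over the coordinate ring of a chart. -/
noncomputable abbrev chartModule : Module A (M.presheaf.stalk (j y)) :=
  Module.compHom _ (chartRingHom j y)

lemma germ_chart_smul (V : (Spec A).Opens) (hy : y ∈ V) (r : A) (m : Γ(M.restrict j, V)) :
    M.presheaf.germ (j ''ᵁ V) (j y) ⟨y, hy, rfl⟩ (r • m : Γ(M.restrict j, V)) =
      chartRingHom j y r • M.presheaf.germ (j ''ᵁ V) (j y) ⟨y, hy, rfl⟩ m := by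
  rw [chartRingHom_eq j y V hy]
  exact stalk_germ_smul M (j y) (j ''ᵁ V) ⟨y, hy, rfl⟩ _ _

/-- The germ map on sections over a chart. -/
noncomputable def chartGerm :
    letI := chartModule j y M
    ChartSections j M →ₗ[A] M.presheaf.stalk (j y) :=
  letI := chartModule j y M
  { __ := (M.presheaf.germ (j ''ᵁ ⊤) (j y) ⟨y, trivial, rfl⟩).hom
    map_smul' r m := germ_chart_smul j y M ⊤ trivial r m }

/-- Quasi-coherence makes sections over D(f) the localization at f of the sections over the chart,
and the D(f) containing y are cofinal among neighbourhoods of y. -/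
lemma isLocalizedModule_chartGerm [M.IsQuasicoherent] :
    letI := chartModule j y M
    IsLocalizedModule (PrimeSpectrum.asIdeal y).primeCompl (chartGerm j y M) := by
  let := chartModule j y M
  let := chartAlgebra j y
  have := isLocalization_chart j y
  have hqc : (M.restrict j).IsQuasicoherent := isQuasicoherent_restrictFunctor j M
  have hloc := (isIso_fromTildeΓ_iff_isLocalizing _).mp
    ((isQuasicoherent_iff_isIso_fromTildeΓ (M.restrict j)).mp hqc)
  refine ⟨fun s ↦ ?_, fun m ↦ ?_, fun {m m'} h ↦ ?_⟩
  · rw [Module.End.isUnit_iff]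
    exact MulAction.bijective (IsLocalization.map_units (X.presheaf.stalk (j y)) s).unit
  · obtain ⟨V, hV, t, rfl⟩ := TopCat.Presheaf.exists_germ_eq M.presheaf m
    obtain ⟨_, ⟨_, ⟨f, rfl⟩, rfl⟩, hyf, hfV⟩ :=
      PrimeSpectrum.isBasis_basic_opens.exists_subset_of_mem_open
        (show y ∈ (j ⁻¹ᵁ V : Set (Spec A)) from hV) (j ⁻¹ᵁ V).2
    have hf : j ''ᵁ (PrimeSpectrum.basicOpen f : (Spec A).Opens) ≤ V := by
      rintro _ ⟨z, hz, rfl⟩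
      exact hfV hz
    let t' : Γ(M.restrict j, PrimeSpectrum.basicOpen f) := M.presheaf.map (homOfLE hf).op t
    have ht' : M.presheaf.germ (j ''ᵁ (PrimeSpectrum.basicOpen f : (Spec A).Opens)) (j y)
        ⟨y, hyf, rfl⟩ t' = M.presheaf.germ V (j y) hV t :=
      TopCat.Presheaf.germ_res_apply M.presheaf _ _ _ _
    obtain ⟨⟨l, ⟨_, n, rfl⟩⟩, hl⟩ := (hloc f).surj t'
    refine ⟨⟨l, f ^ n, fun h ↦ hyf ((PrimeSpectrum.isPrime y).mem_of_pow_mem _ h)⟩, ?_⟩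
    rw [← ht']
    refine (germ_chart_smul j y M _ hyf (f ^ n) t').symm.trans ?_
    refine (congrArg _ hl).trans ?_
    exact TopCat.Presheaf.germ_res_apply M.presheaf _ _ _ _
  · obtain ⟨W, hW, iU, iV, e⟩ := TopCat.Presheaf.germ_eq M.presheaf (j y) _ _ m m' h
    obtain ⟨_, ⟨_, ⟨f, rfl⟩, rfl⟩, hyf, hfW⟩ :=
      PrimeSpectrum.isBasis_basic_opens.exists_subset_of_mem_open
        (show y ∈ (j ⁻¹ᵁ W : Set (Spec A)) from hW) (j ⁻¹ᵁ W).2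
    have hf : j ''ᵁ (PrimeSpectrum.basicOpen f : (Spec A).Opens) ≤ W := by
      rintro _ ⟨z, hz, rfl⟩
      exact hfW hz
    have hcomp (i : W ⟶ j ''ᵁ ⊤) (m : ChartSections j M) :
        M.presheaf.map (homOfLE hf).op (M.presheaf.map i.op m) = (M.restrict j).presheaf.map
          (PrimeSpectrum.basicOpen f : (Spec A).Opens).leTop.op m :=
      congr($((M.presheaf.map_comp i.op (homOfLE hf).op).symm) m)
    obtain ⟨⟨_, n, rfl⟩, hn⟩ := (hloc f).exists_of_eq ((hcomp iU m).symm.trans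
      ((congrArg (M.presheaf.map (homOfLE hf).op) e).trans (hcomp iV m')))
    exact ⟨⟨f ^ n, fun h ↦ hyf ((PrimeSpectrum.isPrime y).mem_of_pow_mem _ h)⟩, hn⟩

end AlgebraicGeometry.Scheme.Modules

/-! ### Finite generation of the stalks of a coherent sheaf. -/

namespace AlgebraicGeometry.Scheme.Modules

variable {X : Scheme.{u}}

/-- Both sheaves come from modules. The tilde functor is full and reflects epimorphisms, so `p`
comes from a surjection of a finite free module onto the sections. -/
lemma finite_sections_of_epi {A : CommRingCat.{u}} {M : (Spec A).Modules}
    [M.IsQuasicoherent] {ι : Type u} [Finite ι] {F : (Spec A).Modules}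
    (e : F ≅ SheafOfModules.free.{u} ι) (p : F ⟶ M) (hp : Epi p) :
    Module.Finite A Γ(M, ⊤) := by
  have hM : IsIso M.fromTildeΓ := (isQuasicoherent_iff_isIso_fromTildeΓ M).mp inferInstance
  let L : ModuleCat A := (modulesSpecToSheaf.obj M).presheaf.obj (op ⊤)
  obtain ⟨t⟩ : Nonempty ((tilde.functor A).obj L ≅ M) := ⟨@asIso _ _ _ _ M.fromTildeΓ hM⟩
  obtain ⟨e'⟩ : Nonempty ((tilde.functor A).obj (ModuleCat.of A (ι →₀ A)) ≅ F) :=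
    ⟨tildeFinsupp ι ≪≫ e.symm⟩
  let h : (tilde.functor A).obj (ModuleCat.of A (ι →₀ A)) ⟶ (tilde.functor A).obj L :=
    e'.hom ≫ p ≫ t.inv
  let g : ModuleCat.of A (ι →₀ A) ⟶ L := (tilde.functor A).preimage h
  have hg : Epi g := by
    refine (tilde.functor A).epi_of_epi_map ?_
    rw [(tilde.functor A).map_preimage]
    exact epi_comp' inferInstance (epi_comp' inferInstance inferInstance)
  have : Module.Finite A (ι →₀ A) := inferInstance
  exact Module.Finite.of_surjective (M := ι →₀ A) (P := L) g.hom
    ((ModuleCat.epi_iff_surjective g).mp hg)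

lemma exists_chart_finite (M : X.Modules) (hM : M.IsCoherent) (x : X) :
    ∃ (A : CommRingCat.{u}) (j : Spec A ⟶ X) (_ : IsOpenImmersion j) (y : Spec A), j y = x ∧
      Module.Finite A (ChartSections j M) := by
  have := hM.isQuasicoherent
  have := hM.isFiniteType
  obtain ⟨⟨I, U, cov, gen⟩, ⟨hfin⟩⟩ :=
    SheafOfModules.IsFiniteType.exists_localGeneratorsData (M := M)
  rw [Opens.coversTop_iff, TopologicalSpace.IsOpenCover] at cov
  obtain ⟨i, hi⟩ := TopologicalSpace.Opens.mem_iSup (x := x).mp (cov.ge (trivial : x ∈ (⊤ : X.Opens)))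
  let U' : X.Opens := U i
  obtain ⟨_, ⟨W, hW, rfl⟩, hxW, hWU⟩ :=
    X.isBasis_affineOpens.exists_subset_of_mem_open hi U'.2
  replace hW : IsAffineOpen W := hW
  replace hWU : W ≤ U' := hWU
  let v : Spec Γ(X, W) ⟶ U' := hW.isoSpec.inv ≫ X.homOfLE hWU
  have : IsOpenImmersion v := IsOpenImmersion.comp _ _
  have : PreservesColimitsOfSize.{u, u} (restrictFunctor v) := inferInstance
  have : PreservesColimitsOfSize.{u, u} (overEquiv U').functor := inferInstance
  let F : SheafOfModules.{u} (X.ringCatSheaf.over U') ⥤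
      SheafOfModules.{u} (Spec Γ(X, W)).ringCatSheaf := (overEquiv U').functor ⋙ restrictFunctor v
  have hF : PreservesColimitsOfSize.{u, u} F :=
    inferInstanceAs (PreservesColimitsOfSize.{u, u} ((overEquiv U').functor ⋙ restrictFunctor v))
  let iso : SheafOfModules.overFunctor X.ringCatSheaf _ ⋙ F ≅ restrictFunctor (v ≫ U'.ι) :=
    (Functor.associator _ _ _).symm ≪≫
      Functor.isoWhiskerRight (overFunctorEquiv _) _ ≪≫ (restrictFunctorComp _ _).symm
  have hfin' := hfin i
  have : (M.restrict (v ≫ U'.ι)).IsQuasicoherent :=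
    isQuasicoherent_restrictFunctor (v ≫ U'.ι) M
  have hv : v ≫ U'.ι = hW.fromSpec := by simp [v]
  refine ⟨_, v ≫ U'.ι, inferInstance, hW.primeIdealOf ⟨x, hxW⟩, ?_, ?_⟩
  · rw [hv]
    exact hW.fromSpec_primeIdealOf ⟨x, hxW⟩
  · let G := ((gen i).map F (restrictUnitIso _).symm).ofEpi (iso.app M).hom
    have : Finite (gen i).I := hfin'.finite
    exact finite_sections_of_epi (ι := (gen i).I) (M := M.restrict (v ≫ U'.ι)) (Iso.refl _) G.π
      G.epi

/-- The stalks of a coherent sheaf are finitely generated. -/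
lemma IsCoherent.finite_stalk {M : X.Modules} (hM : M.IsCoherent) (x : X) :
    Module.Finite (X.presheaf.stalk x) (M.presheaf.stalk x) := by
  obtain ⟨A, j, _, y, rfl, hfin⟩ := exists_chart_finite M hM x
  have := hM.isQuasicoherent
  let := chartModule j y M
  let := chartAlgebra j y
  have := isLocalization_chart j y
  have := isLocalizedModule_chartGerm j y M
  have : IsScalarTower A (X.presheaf.stalk (j y)) (M.presheaf.stalk (j y)) :=
    .of_compHom _ _ _
  exact Module.Finite.of_isLocalizedModule (PrimeSpectrum.asIdeal y).primeCompl
    (chartGerm j y M)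

end AlgebraicGeometry.Scheme.Modules

/-! ### Transport of regular parameters along ring isomorphisms. -/

section RingEquiv

lemma isSMulRegular_map_of_ringEquiv {R S : Type*} [CommRing R] [CommRing S] (e : R ≃+* S)
    {a : R} (ha : IsSMulRegular R a) : IsSMulRegular S (e a) := by
  intro x y h
  apply e.symm.injective
  apply ha
  simpa using congrArg e.symm h

open IsLocalRing

variable {R S : Type*} [CommRing R] [IsLocalRing R] [CommRing S] [IsLocalRing S] (e : R ≃+* S)

include e

lemma IsLocalRing.map_maximalIdeal_of_ringEquiv : (maximalIdeal R).map e = maximalIdeal S :=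
  have : ((maximalIdeal R).map e).IsMaximal := Ideal.map_isMaximal_of_equiv e
  IsLocalRing.eq_maximalIdeal this

lemma IsLocalRing.maximalIdeal_eq_bot_iff_of_ringEquiv :
    maximalIdeal R = ⊥ ↔ maximalIdeal S = ⊥ := by
  rw [← IsLocalRing.map_maximalIdeal_of_ringEquiv e, Ideal.map_eq_bot_iff_of_injective e.injective]

lemma IsRegularParameter.map_ringEquiv {a : R} (h : IsRegularParameter a) :
    IsRegularParameter (e a) where
  isSMulRegular := isSMulRegular_map_of_ringEquiv e h.isSMulRegular
  maximalIdeal_eq := by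
    rw [← IsLocalRing.map_maximalIdeal_of_ringEquiv e, h.maximalIdeal_eq, Ideal.map_span,
      Set.image_singleton]

lemma IsRegularParameterPair.map_ringEquiv {a b : R} (h : IsRegularParameterPair a b) :
    IsRegularParameterPair (e a) (e b) where
  isSMulRegular := isSMulRegular_map_of_ringEquiv e h.isSMulRegular
  dvd_of_dvd_mul c hc := by
    have := h.dvd_of_dvd_mul (e.symm c) ((map_dvd_iff e).mp (by simpa using hc))
    simpa using (map_dvd_iff e).mpr this
  maximalIdeal_eq := by
    rw [← IsLocalRing.map_maximalIdeal_of_ringEquiv e, h.maximalIdeal_eq, Ideal.map_span,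
      Set.image_pair]

lemma HasShortRegularSystem.map_ringEquiv (h : HasShortRegularSystem R) :
    HasShortRegularSystem S := by
  obtain h | ⟨a, h⟩ | ⟨a, b, h⟩ := h
  · exact .inl ((IsLocalRing.maximalIdeal_eq_bot_iff_of_ringEquiv e).mp h)
  · exact .inr (.inl ⟨_, h.map_ringEquiv e⟩)
  · exact .inr (.inr ⟨_, _, h.map_ringEquiv e⟩)

end RingEquiv

/-! ### Étale charts and chains of specializations. -/

namespace AlgebraicGeometry

variable {k : Type u} [Field k]

/-- A smooth surface over a field is locally étale over the affine plane. -/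
lemma exists_etale_chart {X : Scheme.{u}} (f : X ⟶ Spec (CommRingCat.of k))
    [SmoothOfRelativeDimension 2 f] (x : X) :
    ∃ (A : CommRingCat.{u}) (j : Spec A ⟶ X) (_ : IsOpenImmersion j) (y : Spec A)
      (_ : Algebra (MvPolynomial (Fin 2) k) A), Algebra.Etale (MvPolynomial (Fin 2) k) A ∧
        j y = x := by
  obtain ⟨U, hU, V, hV, hxV, e, h⟩ :=
    SmoothOfRelativeDimension.exists_isStandardSmoothOfRelativeDimension (n := 2) (f := f) x
  have hUtop : U = ⊤ := by
    ext z
    simp only [TopologicalSpace.Opens.coe_top, Set.mem_univ, iff_true]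
    have : Subsingleton (PrimeSpectrum k) := inferInstance
    have hz : z = f x := this.elim _ _
    rw [hz]
    exact e hxV
  subst hUtop
  have h' := (RingHom.isStandardSmoothOfRelativeDimension_respectsIso (n := 2)).2 _
    (Scheme.ΓSpecIso (CommRingCat.of k)).symm.commRingCatIsoToRingEquiv h
  obtain ⟨g, -, hg⟩ := h'.exists_etale_mvPolynomial
  refine ⟨Γ(X, V), hV.fromSpec, inferInstance, hV.primeIdealOf ⟨x, hxV⟩, g.toAlgebra, hg,
    hV.fromSpec_primeIdealOf ⟨x, hxV⟩⟩

end AlgebraicGeometry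

lemma two_le_topologicalKrullDim {T : Type*} [TopologicalSpace T] {a b c : T}
    (hab : a ⤳ b) (hba : ¬ b ⤳ a) (hbc : b ⤳ c) (hcb : ¬ c ⤳ b) :
    2 ≤ topologicalKrullDim T := by
  let Z (x : T) : TopologicalSpace.IrreducibleCloseds T :=
    ⟨closure {x}, isIrreducible_singleton.closure, isClosed_closure⟩
  have hZ {x y : T} (h : x ⤳ y) (h' : ¬ y ⤳ x) : Z y < Z x := by
    rw [specializes_iff_closure_subset] at h h'
    exact ⟨h, h'⟩
  let s : LTSeries (TopologicalSpace.IrreducibleCloseds T) :=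
    { length := 2
      toFun := ![Z c, Z b, Z a]
      step := fun i ↦ by
        fin_cases i
        · exact hZ hbc hcb
        · exact hZ hab hba }
  exact Order.LTSeries.length_le_krullDim s

/-! ### Associated points and torsion stalks on a smooth surface. -/

namespace AlgebraicGeometry.Scheme.Modules

open IsLocalRing

section Chart

variable {A : CommRingCat.{u}} {X : Scheme.{u}} (j : Spec A ⟶ X) [IsOpenImmersion j] (y : Spec A)

/-- The stalk at a point of a chart as a localization of the coordinate ring. -/
noncomputable def localizationEquivStalk :
    Localization.AtPrime (PrimeSpectrum.asIdeal y) ≃+* X.presheaf.stalk (j y) :=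
  letI := chartAlgebra j y
  haveI := isLocalization_chart j y
  (IsLocalization.algEquiv (PrimeSpectrum.asIdeal y).primeCompl
    (Localization.AtPrime (PrimeSpectrum.asIdeal y)) (X.presheaf.stalk (j y))).toRingEquiv

lemma isNoetherianRing_stalk_chart [IsNoetherianRing A] :
    IsNoetherianRing (X.presheaf.stalk (j y)) :=
  isNoetherianRing_of_ringEquiv _ (localizationEquivStalk j y)

lemma chartRingHom_eq_zero_iff (r : A) :
    chartRingHom j y r = 0 ↔ ∃ t : A, t ∉ PrimeSpectrum.asIdeal y ∧ t * r = 0 := by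
  let := chartAlgebra j y
  have := isLocalization_chart j y
  refine (IsLocalization.map_eq_zero_iff (PrimeSpectrum.asIdeal y).primeCompl
    (X.presheaf.stalk (j y)) r).trans ?_
  exact ⟨fun ⟨t, h⟩ ↦ ⟨t, t.2, h⟩, fun ⟨t, ht, h⟩ ↦ ⟨⟨t, ht⟩, h⟩⟩

lemma comap_chartRingHom_le {p : Ideal (X.presheaf.stalk (j y))} (hp : p ≠ ⊤) :
    p.comap (chartRingHom j y) ≤ PrimeSpectrum.asIdeal y := by
  let := chartAlgebra j y
  have := isLocalization_chart j y
  have h : (maximalIdeal (X.presheaf.stalk (j y))).comap (chartRingHom j y) =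
      PrimeSpectrum.asIdeal y := IsLocalization.AtPrime.under_maximalIdeal _ _
  exact (Ideal.comap_mono (le_maximalIdeal hp)).trans h.le

lemma comap_chartRingHom_maximalIdeal :
    (maximalIdeal (X.presheaf.stalk (j y))).comap (chartRingHom j y) = PrimeSpectrum.asIdeal y := by
  let := chartAlgebra j y
  have := isLocalization_chart j y
  exact IsLocalization.AtPrime.under_maximalIdeal _ _

variable {y} in
lemma specializes_chart_iff {z : Spec A} :
    j z ⤳ j y ↔ PrimeSpectrum.asIdeal z ≤ PrimeSpectrum.asIdeal y := by
  rw [j.isOpenEmbedding.isInducing.specializes_iff]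
  exact (PrimeSpectrum.le_iff_specializes z y).symm

lemma maximalIdeal_stalk_eq_bot_iff : maximalIdeal (X.presheaf.stalk (j y)) = ⊥ ↔
    maximalIdeal (Localization.AtPrime (PrimeSpectrum.asIdeal y)) = ⊥ :=
  (maximalIdeal_eq_bot_iff_of_ringEquiv (localizationEquivStalk j y)).symm

/-- The local ring at the zero ideal of a local domain is a field. -/
lemma maximalIdeal_stalk_eq_bot_of_comap_bot [IsDomain (X.presheaf.stalk (j y))] {z : Spec A}
    (hz : PrimeSpectrum.asIdeal z = (⊥ : Ideal _).comap (chartRingHom j y)) :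
    maximalIdeal (X.presheaf.stalk (j z)) = ⊥ := by
  let := chartAlgebra j z
  have := isLocalization_chart j z
  rw [← IsLocalization.AtPrime.map_eq_maximalIdeal (PrimeSpectrum.asIdeal z), eq_bot_iff,
    Ideal.map_le_iff_le_comap]
  intro r hr
  rw [hz, Ideal.mem_comap, Ideal.mem_bot, chartRingHom_eq_zero_iff] at hr
  obtain ⟨t, ht, htr⟩ := hr
  refine (chartRingHom_eq_zero_iff j z r).mpr ⟨t, fun h ↦ ht ?_, htr⟩
  rw [hz] at h
  exact comap_chartRingHom_le j y bot_ne_top h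

variable (M : X.Modules) [M.IsQuasicoherent]

lemma chartGerm_eq_zero_iff (l : ChartSections j M) :
    letI := chartModule j y M
    chartGerm j y M l = 0 ↔ ∃ t : A, t ∉ PrimeSpectrum.asIdeal y ∧ t • l = 0 := by
  let := chartModule j y M
  have := isLocalizedModule_chartGerm j y M
  refine (IsLocalizedModule.eq_zero_iff (PrimeSpectrum.asIdeal y).primeCompl
    (chartGerm j y M)).trans ?_
  exact ⟨fun ⟨t, h⟩ ↦ ⟨t, t.2, h⟩, fun ⟨t, ht, h⟩ ↦ ⟨⟨t, ht⟩, h⟩⟩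

lemma exists_smul_eq_chartGerm (m : M.presheaf.stalk (j y)) :
    ∃ s ∉ PrimeSpectrum.asIdeal y, ∃ l : ChartSections j M,
      chartRingHom j y s • m = letI := chartModule j y M; chartGerm j y M l := by
  let := chartModule j y M
  have := isLocalizedModule_chartGerm j y M
  obtain ⟨⟨l, s⟩, h⟩ := IsLocalizedModule.surj (PrimeSpectrum.asIdeal y).primeCompl
    (chartGerm j y M) m
  exact ⟨s, s.2, l, h⟩

lemma isUnit_chartRingHom {s : A} (hs : s ∉ PrimeSpectrum.asIdeal y) :
    IsUnit (chartRingHom j y s) := by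
  let := chartAlgebra j y
  have := isLocalization_chart j y
  exact IsLocalization.map_units (X.presheaf.stalk (j y))
    (⟨s, hs⟩ : (PrimeSpectrum.asIdeal y).primeCompl)

lemma subsingleton_stalk_chart_iff : Subsingleton (M.presheaf.stalk (j y)) ↔
    ∀ l : ChartSections j M, ∃ t : A, t ∉ PrimeSpectrum.asIdeal y ∧ t • l = 0 := by
  simp only [← chartGerm_eq_zero_iff]
  refine ⟨fun _ l ↦ Subsingleton.elim _ _, fun h ↦ subsingleton_of_forall_eq 0 fun m ↦ ?_⟩
  obtain ⟨s, hs, l, hl⟩ := exists_smul_eq_chartGerm j y M m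
  rw [← (isUnit_chartRingHom j y hs).smul_eq_zero, hl]
  exact h l

lemma mem_associatedPrimes_stalk_iff [IsNoetherianRing A] (p : Ideal (X.presheaf.stalk (j y))) :
    p ∈ associatedPrimes (X.presheaf.stalk (j y)) (M.presheaf.stalk (j y)) ↔
      p.comap (chartRingHom j y) ∈ associatedPrimes A (ChartSections j M) := by
  let := chartModule j y M
  let := chartAlgebra j y
  have := isLocalization_chart j y
  have := isLocalizedModule_chartGerm j y M
  have : IsScalarTower A (X.presheaf.stalk (j y)) (M.presheaf.stalk (j y)) :=
    .of_compHom _ _ _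
  rw [← Module.associatedPrimes.preimage_comap_associatedPrimes_eq_associatedPrimes_of_isLocalizedModule
    (PrimeSpectrum.asIdeal y).primeCompl (X.presheaf.stalk (j y)) (chartGerm j y M)]
  rfl

lemma mem_associatedPoints_chart_iff [IsNoetherianRing A] : j y ∈ M.associatedPoints ↔
    PrimeSpectrum.asIdeal y ∈ associatedPrimes A (ChartSections j M) := by
  refine (mem_associatedPrimes_stalk_iff j y M _).trans ?_
  rw [comap_chartRingHom_maximalIdeal]

/-- This turns associated primes of a stalk, at any point of a chart, into associated points of the
sheaf. -/
lemma exists_mem_associatedPoints [IsNoetherianRing A] {p : Ideal (X.presheaf.stalk (j y))}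
    (hp : p ∈ associatedPrimes (X.presheaf.stalk (j y)) (M.presheaf.stalk (j y))) :
    ∃ z : Spec A, PrimeSpectrum.asIdeal z = p.comap (chartRingHom j y) ∧
      j z ∈ M.associatedPoints := by
  have := hp.isPrime
  exact ⟨⟨p.comap (chartRingHom j y), inferInstance⟩, rfl, (mem_associatedPoints_chart_iff j _ M).mpr
    ((mem_associatedPrimes_stalk_iff j y M p).mp hp)⟩

end Chart

lemma associatedPoints_subset_support {X : Scheme.{u}} (M : X.Modules) :
    M.associatedPoints ⊆ M.support := by
  intro x hx
  by_contra h
  have : Subsingleton (M.presheaf.stalk x) := not_nontrivial_iff_subsingleton.mp h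
  exact (associatedPrimes.eq_empty_of_subsingleton (R := X.presheaf.stalk x)
    (M := M.presheaf.stalk x)).le hx

section Surface

variable {k : Type u} [Field k] {X : Scheme.{u}}

lemma exists_affine_chart (x : X) :
    ∃ (A : CommRingCat.{u}) (j : Spec A ⟶ X) (_ : IsOpenImmersion j) (y : Spec A), j y = x := by
  obtain ⟨_, ⟨W, hW, rfl⟩, hxW, -⟩ :=
    X.isBasis_affineOpens.exists_subset_of_mem_open (Set.mem_univ x) isOpen_univ
  replace hW : IsAffineOpen W := hW
  exact ⟨_, hW.fromSpec, inferInstance, _, hW.fromSpec_primeIdealOf ⟨x, hxW⟩⟩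

lemma mem_support_of_specializes (M : X.Modules) [M.IsQuasicoherent] {v w : X}
    (h : v ⤳ w) (hv : v ∈ M.support) : w ∈ M.support := by
  obtain ⟨A, j, _, y, rfl⟩ := exists_affine_chart w
  obtain ⟨z, rfl⟩ := h.mem_open j.isOpenEmbedding.isOpen_range ⟨y, rfl⟩
  rw [specializes_chart_iff] at h
  by_contra hw
  rw [support, Set.mem_ofPred_eq, not_nontrivial_iff_subsingleton, subsingleton_stalk_chart_iff] at hw
  refine not_subsingleton_iff_nontrivial.mpr hv
    ((subsingleton_stalk_chart_iff _ _ M).mpr fun l ↦ ?_)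
  obtain ⟨t, ht, htl⟩ := hw l
  exact ⟨t, fun h' ↦ ht (h h'), htl⟩

lemma isNoetherianRing_of_etale_plane (k : Type*) [Field k] (A : Type*) [CommRing A]
    [Algebra (MvPolynomial (Fin 2) k) A] [Algebra.Etale (MvPolynomial (Fin 2) k) A] :
    IsNoetherianRing A :=
  Algebra.FiniteType.isNoetherianRing (MvPolynomial (Fin 2) k) A

lemma isNoetherianRing_stalk (f : X ⟶ Spec (CommRingCat.of k))
    [SmoothOfRelativeDimension 2 f] (x : X) : IsNoetherianRing (X.presheaf.stalk x) := by
  obtain ⟨A, j, _, y, _, _, rfl⟩ := exists_etale_chart f x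
  have := isNoetherianRing_of_etale_plane k A
  exact isNoetherianRing_stalk_chart j y

variable [IsAlgClosed k]

lemma hasShortRegularSystem_stalk (f : X ⟶ Spec (CommRingCat.of k))
    [SmoothOfRelativeDimension 2 f] (x : X) : HasShortRegularSystem (X.presheaf.stalk x) := by
  obtain ⟨A, j, _, y, _, _, rfl⟩ := exists_etale_chart f x
  exact (hasShortRegularSystem_of_etale (PrimeSpectrum.asIdeal y) k).map_ringEquiv
    (localizationEquivStalk j y)

/-- Points of the support of a torsion sheaf on a smooth surface are not generic. -/
lemma IsSupportedOnPointsAndCurves.maximalIdeal_ne_bot {M : X.Modules}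
    (hM : M.IsSupportedOnPointsAndCurves) (f : X ⟶ Spec (CommRingCat.of k))
    [SmoothOfRelativeDimension 2 f] {x : X} (hx : x ∈ M.support) :
    maximalIdeal (X.presheaf.stalk x) ≠ ⊥ := by
  obtain ⟨P, C, -, hP, -, hC, hPC⟩ := hM
  obtain ⟨A, j, _, y, _, _, rfl⟩ := exists_etale_chart f x
  have := isNoetherianRing_of_etale_plane k A
  rw [Ne, maximalIdeal_stalk_eq_bot_iff]
  intro hbot
  rw [hPC] at hx
  rcases hx with hx | ⟨Z, hZ, hx⟩
  -- A closed point has a regular pair of parameters, so its maximal ideal is nonzero.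
  · have hy : IsClosed {y} := by
      have h := (hP _ hx).preimage j.continuous
      rwa [← Set.image_singleton, j.isOpenEmbedding.injective.preimage_image] at h
    obtain ⟨a, b, h⟩ := exists_isRegularParameterPair_of_isMaximal (PrimeSpectrum.asIdeal y) k
      ((PrimeSpectrum.isClosed_singleton_iff_isMaximal y).mp hy)
    have := h.bot_lt_lt
    rw [hbot] at this
    exact (this.1.trans this.2).false
  · obtain ⟨hZc, -, hdim⟩ := hC Z hZ
    -- A generic point on Z would give, below a closed point of the chart, a chain of two strict
    -- specializations inside Z, too long for a curve.
    obtain ⟨c, hc, hyc⟩ := (PrimeSpectrum.asIdeal y).exists_le_maximal (PrimeSpectrum.isPrime y).ne_top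
    have := hc.isPrime
    obtain ⟨z, hz, hyz, hzc⟩ := exists_prime_lt_lt_of_maximalIdeal_eq_bot hyc hbot
      (exists_isRegularParameterPair_of_isMaximal c k hc)
    let z' : Spec A := ⟨z, hz⟩
    let c' : Spec A := ⟨c, this⟩
    have h1 : j y ⤳ j z' := (specializes_chart_iff j).mpr hyz.le
    have h2 : ¬ j z' ⤳ j y := fun h ↦ hyz.not_ge ((specializes_chart_iff j).mp h)
    have h3 : j z' ⤳ j c' := (specializes_chart_iff j).mpr hzc.le
    have h4 : ¬ j c' ⤳ j z' := fun h ↦ hzc.not_ge ((specializes_chart_iff j).mp h)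
    have hz' : j z' ∈ Z := h1.mem_closed hZc hx
    have hc' : j c' ∈ Z := h3.mem_closed hZc hz'
    have h := two_le_topologicalKrullDim (T := Z) (a := ⟨_, hx⟩) (b := ⟨_, hz'⟩) (c := ⟨_, hc'⟩)
      (Topology.IsInducing.subtypeVal.specializes_iff.mp h1) (fun h ↦ h2 (Topology.IsInducing.subtypeVal.specializes_iff.mpr h))
      (Topology.IsInducing.subtypeVal.specializes_iff.mp h3) (fun h ↦ h4 (Topology.IsInducing.subtypeVal.specializes_iff.mpr h))
    rw [hdim] at h
    norm_num at h

lemma IsSupportedOnPointsAndCurves.exists_smul_eq_zero {M : X.Modules}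
    (hM : M.IsSupportedOnPointsAndCurves) (hM' : M.IsCoherent) (f : X ⟶ Spec (CommRingCat.of k))
    [SmoothOfRelativeDimension 2 f] (x : X) : ∃ s : X.presheaf.stalk x, s ≠ 0 ∧
      ∀ m : M.presheaf.stalk x, s • m = 0 := by
  have := hM'.isQuasicoherent
  have := hM'.finite_stalk x
  have := isNoetherianRing_stalk f x
  have := (hasShortRegularSystem_stalk f x).isDomain
  suffices h : Module.IsTorsion (X.presheaf.stalk x) (M.presheaf.stalk x) by
    obtain ⟨s, hs, hs0⟩ := Submodule.annihilator_top_inter_nonZeroDivisors h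
    exact ⟨s, nonZeroDivisors.ne_zero hs0, fun m ↦ Submodule.mem_annihilator.mp hs m trivial⟩
  obtain ⟨A, j, _, y, rfl⟩ := exists_affine_chart x
  have hbot : (⊥ : Ideal (X.presheaf.stalk (j y))).IsPrime := Ideal.isPrime_bot
  -- This is the generic point of the local domain. The stalk of M vanishes there, so every element
  -- of the stalk at y is torsion; finite generation gives a common annihilator.
  let z : Spec A := ⟨(⊥ : Ideal _).comap (chartRingHom j y), inferInstance⟩
  have hz : Subsingleton (M.presheaf.stalk (j z)) := by
    by_contra h
    exact hM.maximalIdeal_ne_bot f (not_subsingleton_iff_nontrivial.mp h)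
      (maximalIdeal_stalk_eq_bot_of_comap_bot j y rfl)
  intro m
  obtain ⟨s, hs, l, hl⟩ := exists_smul_eq_chartGerm j y M m
  obtain ⟨t, ht, htl⟩ := (subsingleton_stalk_chart_iff j z M).mp hz l
  have ht0 : chartRingHom j y t ≠ 0 := ht
  refine ⟨⟨chartRingHom j y t * chartRingHom j y s, mem_nonZeroDivisors_of_ne_zero
    (mul_ne_zero ht0 (isUnit_chartRingHom j y hs).ne_zero)⟩, ?_⟩
  change (chartRingHom j y t * chartRingHom j y s) • m = 0
  let := chartModule j y M
  rw [mul_smul, hl]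
  refine ((chartGerm j y M).map_smul t l).symm.trans ?_
  rw [htl, map_zero]

/-- At w both stalks are nonzero, since supports are stable under specialization; moreover 𝔪 is
associated to N there, nonzero, and T is torsion. -/
lemma not_torOneVanishes_of_specializes (f : X ⟶ Spec (CommRingCat.of k))
    [SmoothOfRelativeDimension 2 f] {T N : X.Modules} (hT : T.IsCoherent) (hN : N.IsCoherent)
    (hT' : T.IsSupportedOnPointsAndCurves) (hN' : N.IsSupportedOnPointsAndCurves) {v w : X}
    (hv : v ∈ T.associatedPoints) (hw : w ∈ N.associatedPoints) (h : v ⤳ w) :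
    ¬ TorOneVanishes (X.presheaf.stalk w) (T.presheaf.stalk w) (N.presheaf.stalk w) := by
  have := hT.isQuasicoherent
  have := hT.finite_stalk w
  have := hN.finite_stalk w
  have := isNoetherianRing_stalk f w
  have : Nontrivial (T.presheaf.stalk w) :=
    mem_support_of_specializes T h (associatedPoints_subset_support T hv)
  obtain ⟨s, hs, hsT⟩ := hT'.exists_smul_eq_zero hT f w
  exact (hasShortRegularSystem_stalk f w).not_torOneVanishes
    (hN'.maximalIdeal_ne_bot f (associatedPoints_subset_support N hw)) hs hsT hw

lemma exists_specializes_of_not_torOneVanishes (f : X ⟶ Spec (CommRingCat.of k))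
    [SmoothOfRelativeDimension 2 f] {T N : X.Modules} (hT : T.IsCoherent) (hN : N.IsCoherent)
    {x : X}
    (h : ¬ TorOneVanishes (X.presheaf.stalk x) (T.presheaf.stalk x) (N.presheaf.stalk x)) :
    ∃ v ∈ T.associatedPoints, ∃ w ∈ N.associatedPoints, v ⤳ w ∨ w ⤳ v := by
  have := hT.isQuasicoherent
  have := hN.isQuasicoherent
  have := hT.finite_stalk x
  have := hN.finite_stalk x
  have := isNoetherianRing_stalk f x
  obtain ⟨p, hp, q, hq, hpq⟩ := (hasShortRegularSystem_stalk f x).exists_associatedPrimes_le h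
  obtain ⟨A, j, _, y, _, _, rfl⟩ := exists_etale_chart f x
  have := isNoetherianRing_of_etale_plane k A
  obtain ⟨v, hv, hvT⟩ := exists_mem_associatedPoints j y T hp
  obtain ⟨w, hw, hwN⟩ := exists_mem_associatedPoints j y N hq
  refine ⟨_, hvT, _, hwN, ?_⟩
  rw [specializes_chart_iff, specializes_chart_iff, hv, hw]
  exact hpq.imp (fun h ↦ Ideal.comap_mono h) (fun h ↦ Ideal.comap_mono h)

end Surface

end AlgebraicGeometry.Scheme.Modules

theorem mainTheorem8 {k : Type u} [Field k] [IsAlgClosed k]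
    {X : Scheme.{u}} (f : X ⟶ Spec (CommRingCat.of k))
    [SmoothOfRelativeDimension 2 f] [IsSeparated f] [QuasiCompact f]
    (T N : X.Modules) (hT : T.IsCoherent) (hN : N.IsCoherent)
    (hT' : T.IsSupportedOnPointsAndCurves) (hN' : N.IsSupportedOnPointsAndCurves) :
    ¬ IsZero (Scheme.Modules.torSheaf 1 T N) ↔
      (∃ V ∈ T.associatedSubvarieties, ∃ W ∈ N.associatedSubvarieties, W ⊆ V) ∨
      (∃ V ∈ T.associatedSubvarieties, ∃ W ∈ N.associatedSubvarieties, V ⊆ W) := by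
  rw [Scheme.Modules.not_isZero_torSheaf_one_iff]
  constructor
  · rintro ⟨x, hx⟩
    obtain ⟨v, hv, w, hw, h | h⟩ :=
      Scheme.Modules.exists_specializes_of_not_torOneVanishes f hT hN hx
    · exact .inl ⟨_, ⟨v, hv, rfl⟩, _, ⟨w, hw, rfl⟩, h.closure_subset⟩
    · exact .inr ⟨_, ⟨v, hv, rfl⟩, _, ⟨w, hw, rfl⟩, h.closure_subset⟩
  · rintro (⟨_, ⟨v, hv, rfl⟩, _, ⟨w, hw, rfl⟩, h⟩ | ⟨_, ⟨v, hv, rfl⟩, _, ⟨w, hw, rfl⟩, h⟩)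
    · exact ⟨w, Scheme.Modules.not_torOneVanishes_of_specializes f hT hN hT' hN' hv hw
        (specializes_iff_closure_subset.mpr h)⟩
    · exact ⟨v, fun h0 ↦ Scheme.Modules.not_torOneVanishes_of_specializes f hN hT hN' hT' hw hv
        (specializes_iff_closure_subset.mpr h) ((TorOneVanishes.comm _ _ _).mp h0)⟩
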